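/- Let $n\ge 1$ be an integer and let $\mathrm{Div}(n)$ be the set of positive divisors of $n$. A *Wajsberg algebra* is an algebra $\langle A,\to,\neg,1\rangle$ of type $(2,1,0)$ satisfying $1\to x=x$, $(x\to y)\to((y\to z)\to(x\to z))=1$, $(x\to y)\to y=(y\to x)\to x$ and $(\neg y\to\neg x)\to(x\to y)=1$. Put $x\vee y=(x\to y)\to y$, $x\odot y=\neg(x\to\neg y)$, and $x\le y$ iff $x\to y=1$. The interval $[0,1]$ with $x\to y=\min\{1,1-x+y\}$ and $\neg x=1-x$ is a Wajsberg algebra; for $d\ge 1$, $L_{d+1}$ is its subalgebra $\{0,\frac1d,\dots,\frac{d-1}{d},1\}$. A Wajsberg algebra is *$(n+1)$-valued* if it belongs to the variety generated by $L_{n+1}$. Let $\mathcal W^{n+1}$ be the category of $(n+1)$-valued Wajsberg algebras and their homomorphisms. Let $\mathcal B^{n+1}$ be the category whose objects are the pairs $\langle B,h\rangle$, where $B$ is a Boolean algebra and $h$ is a function from $\mathrm{Div}(n)$ to the lattice of (possibly improper) filters of $B$ such that $h(n)=\{1\}$ and $h(\gcd(d,r))=h(d)\vee h(r)$ for all $d,r\in\mathrm{Div}(n)$.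 A morphism $\langle B_1,h_1\rangle\to\langle B_2,h_2\rangle$ is a Boolean homomorphism $\theta:B_1\to B_2$ with $h_1(d)\subseteq\theta^{-1}(h_2(d))$ for every $d\in\mathrm{Div}(n)$. For an $(n+1)$-valued Wajsberg algebra $A$, let $B(A)=\{x\in A: x\odot x=x\}$, a Boolean algebra in the order of $A$. An *implicative filter* of $A$ is a subset $F$ with $1\in F$ such that $a,\,a\to b\in F$ imply $b\in F$; it is *prime* if it is proper and $x\vee y\in F$ implies $x\in F$ or $y\in F$. For $d\in\mathrm{Div}(n)$ let $h_A(d)=B(A)\cap P_d$, where $P_d$ is the intersection of all prime implicative filters $P$ of $A$ such that $A/P$ embeds in $L_{d+1}$ (and $P_d = A$ if there are none). The assignments $A\mapsto\langle B(A),h_A\rangle$ on objects and $g\mapsto g|_{B(A_1)}$ on homomorphisms $g:A_1\to A_2$ define a functor $\mathbf B:\mathcal W^{n+1}\to\mathcal B^{n+1}$. For $\langle B,h\rangle$ in $\mathcal B^{n+1}$, let $M(B,h)$ be the set of all increasing functions $f:\{1,\dots,n\}\to B$ such that $f(q\tfrac nd)\to f((q-1)\tfrac nd+1)\in h(d)$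 for all $d\in\mathrm{Div}(n)$ and $1\le q\le d$, with the operations $(\neg f)(k)=\neg f(n+1-k)$ and $(f\to g)(k)=\bigwedge_{i=1}^{n-k+1}\bigl(f(i)\to g(i+k-1)\bigr)$, and with the constant function $1$ as unit. The assignments $\langle B,h\rangle\mapsto M(B,h)$ on objects and $g\mapsto(f\mapsto g\circ f)$ on morphisms define a functor $\mathbf M:\mathcal B^{n+1}\to\mathcal W^{n+1}$. **Theorem.** The functors $\mathbf B$ and $\mathbf M$ form an equivalence between the categories $\mathcal W^{n+1}$ and $\mathcal B^{n+1}$: the composite functors $\mathbf M\mathbf B$ and $\mathbf B\mathbf M$ are naturally isomorphic to the identity functors of $\mathcal W^{n+1}$ and $\mathcal B^{n+1}$ respectively. -/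

import Mathlib

open CategoryTheory

universe u v w

namespace Wajsberg

/-! ### Wajsberg algebras and their homomorphisms -/

/-- A Wajsberg algebra `⟨A, →, ¬, 1⟩`. -/
class WajsbergAlgebra (A : Type u) where
  imp : A → A → A
  neg : A → A
  one : A
  one_imp : ∀ x, imp one x = x
  imp_trans : ∀ x y z, imp (imp x y) (imp (imp y z) (imp x z)) = one
  imp_comm : ∀ x y, imp (imp x y) y = imp (imp y x) x
  neg_imp_neg : ∀ x y, imp (imp (neg y) (neg x)) (imp x y) = one

open WajsbergAlgebra

infixr:60 " ⇾ " => WajsbergAlgebra.imp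

/-- Homomorphisms of Wajsberg algebras. -/
@[ext]
structure WHom (A : Type u) (B : Type v) [WajsbergAlgebra A] [WajsbergAlgebra B] where
  toFun : A → B
  map_imp : ∀ x y, toFun (x ⇾ y) = toFun x ⇾ toFun y
  map_neg : ∀ x, toFun (neg x) = neg (toFun x)
  map_one : toFun one = one

section Basic

variable {A : Type u} [WajsbergAlgebra A]

/-- `x ⊙ y = ¬(x → ¬y)`. -/
def odot (x y : A) : A := neg (x ⇾ neg y)

/-- `x ∨ y = (x → y) → y`. -/
def join (x y : A) : A := (x ⇾ y) ⇾ y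

theorem w_refl (x : A) : x ⇾ x = one := by
  have h := imp_trans (one : A) one x
  simpa only [one_imp] using h

theorem w_antisymm {x y : A} (h : x ⇾ y = one) (h' : y ⇾ x = one) : x = y := by
  have := imp_comm x y
  rw [h, h', one_imp, one_imp] at this
  exact this.symm

theorem w_trans {x y z : A} (h : x ⇾ y = one) (h' : y ⇾ z = one) : x ⇾ z = one := by
  have := imp_trans x y z
  rwa [h, h', one_imp, one_imp] at this

theorem w_top (x : A) : x ⇾ (one : A) = one := by
  have h1 : (x ⇾ (one : A)) ⇾ one = one := by
    rw [imp_comm, one_imp, w_refl]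
  have h := imp_trans (one : A) x one
  rwa [one_imp, one_imp, h1] at h

theorem w_k (x y : A) : x ⇾ y ⇾ x = one := by
  have h := imp_trans y (one : A) x
  rwa [w_top, one_imp, one_imp] at h

theorem w_le_join_right (x y : A) : y ⇾ (x ⇾ y) ⇾ y = one := w_k _ _

theorem w_le_join_left (x y : A) : x ⇾ (x ⇾ y) ⇾ y = one := by
  rw [imp_comm]; exact w_k _ _

/-- Implication is antitone in the first argument. -/
theorem w_anti {x y : A} (z : A) (h : x ⇾ y = one) : (y ⇾ z) ⇾ x ⇾ z = one := by
  have := imp_trans x y z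
  rwa [h, one_imp] at this

theorem w_exch_le (x y z : A) : (x ⇾ y ⇾ z) ⇾ y ⇾ x ⇾ z = one :=
  w_trans (imp_trans x (y ⇾ z) z) (w_anti (x ⇾ z) (w_le_join_left y z))

theorem w_exch (x y z : A) : x ⇾ y ⇾ z = y ⇾ x ⇾ z :=
  w_antisymm (w_exch_le _ _ _) (w_exch_le _ _ _)

theorem w_mono_trans (x y z : A) : (y ⇾ z) ⇾ (x ⇾ y) ⇾ x ⇾ z = one := by
  rw [w_exch]; exact imp_trans x y z

/-- Implication is monotone in the second argument. -/
theorem w_mono {y z : A} (x : A) (h : y ⇾ z = one) : (x ⇾ y) ⇾ x ⇾ z = one := by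
  have := w_mono_trans x y z
  rwa [h, one_imp] at this

theorem w_bot (x : A) : neg (one : A) ⇾ x = one := by
  have h := w_trans (w_k (neg (one : A)) (neg x)) (neg_imp_neg one x)
  rwa [one_imp] at h

theorem w_neg_eq (x : A) : neg x = x ⇾ neg (one : A) := by
  have h0 : ∀ y : A, neg y ⇾ y ⇾ neg (one : A) = one := fun y =>
    w_trans (w_k (neg y) (neg (neg one))) (neg_imp_neg _ _)
  have h1 : (neg x ⇾ neg (one : A)) ⇾ x = one := by
    have := neg_imp_neg (one : A) x
    rwa [one_imp] at this
  have h2 : (x ⇾ neg (one : A)) ⇾ neg x = one := by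
    have := w_anti (neg (one : A)) h1
    rwa [imp_comm, w_bot, one_imp] at this
  exact w_antisymm (h0 x) h2

theorem w_neg_neg (x : A) : neg (neg x) = x := by
  rw [w_neg_eq (neg x), w_neg_eq x, imp_comm, w_bot, one_imp]

theorem w_contra (x y : A) : x ⇾ y = neg y ⇾ neg x := by
  refine w_antisymm ?_ (neg_imp_neg _ _)
  rw [w_neg_eq x, w_neg_eq y]
  exact imp_trans _ _ _

theorem w_contra' (x y : A) : x ⇾ neg y = y ⇾ neg x := by
  rw [w_contra, w_neg_neg]

theorem odot_comm (x y : A) : odot x y = odot y x := by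
  unfold odot; rw [w_contra']

/-- Residuation. -/
theorem odot_imp (x y z : A) : odot x y ⇾ z = x ⇾ y ⇾ z := by
  unfold odot
  rw [w_contra, w_neg_neg, w_exch, w_contra y z]

theorem odot_assoc (x y z : A) : odot (odot x y) z = odot x (odot y z) := by
  show neg (odot x y ⇾ neg z) = neg (x ⇾ neg (neg (y ⇾ neg z)))
  rw [odot_imp, w_neg_neg]

theorem odot_mono {x x' y y' : A} (h : x ⇾ x' = one) (h' : y ⇾ y' = one) :
    odot x y ⇾ odot x' y' = one := by
  rw [odot_imp]
  have h1 : x' ⇾ y' ⇾ odot x' y' = one := by rw [← odot_imp, w_refl]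
  exact w_trans (w_trans h h1) (w_anti _ h')

end Basic

/-! ### The Boolean elements -/

/-- `B(A) = {x ∈ A : x ⊙ x = x}`. -/
def BoolPart (A : Type u) [WajsbergAlgebra A] : Type u := {x : A // odot x x = x}

section BoolPart

variable {A : Type u} [WajsbergAlgebra A]

theorem bool_contract {b : A} (hb : odot b b = b) (x : A) : b ⇾ b ⇾ x = b ⇾ x := by
  rw [← odot_imp, hb]

theorem bool_neg_imp {b : A} (hb : odot b b = b) : neg b ⇾ b = b := by
  have h : b ⇾ neg b = neg b := by
    have := congrArg neg hb
    rwa [odot, w_neg_neg] at this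
  refine w_antisymm ?_ (w_k _ _)
  have h2 := imp_comm b (neg b)
  rw [h, w_refl] at h2
  exact h2.symm

theorem bool_neg {b : A} (hb : odot b b = b) : odot (neg b) (neg b) = neg b := by
  unfold odot; rw [w_neg_neg, bool_neg_imp hb]

theorem bool_odot {b c : A} (hb : odot b b = b) (hc : odot c c = c) :
    odot (odot b c) (odot b c) = odot b c := by
  rw [odot_assoc, odot_comm b c, ← odot_assoc c c b, hc, odot_comm c b, ← odot_assoc, hb]

theorem bool_imp {b c : A} (hb : odot b b = b) (hc : odot c c = c) :
    odot (b ⇾ c) (b ⇾ c) = b ⇾ c := by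
  have : b ⇾ c = neg (odot b (neg c)) := by unfold odot; rw [w_neg_neg, w_neg_neg]
  rw [this]
  exact bool_neg (bool_odot hb (bool_neg hc))

theorem bool_one : odot (one : A) one = one := by
  unfold odot; rw [one_imp, w_neg_neg]

/-- `B(A)` carries the order of `A`, that is `x ≤ y` iff `x → y = 1`; on Boolean elements the
meet of `x` and `y` is `x ⊙ y` and their join is `x ⊕ y = ¬x → y`. The Heyting implication is the
implication of `A` and the complement is the negation of `A`. -/
instance : HeytingAlgebra (BoolPart A) where
  le x y := x.1 ⇾ y.1 = one
  le_refl x := w_refl _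
  le_trans x y z h h' := w_trans h h'
  le_antisymm x y h h' := Subtype.ext (w_antisymm h h')
  sup x y := ⟨neg x.1 ⇾ y.1, bool_imp (bool_neg x.2) y.2⟩
  le_sup_left x y := by
    show x.1 ⇾ neg x.1 ⇾ y.1 = one
    rw [w_contra (neg x.1), w_neg_neg]; exact w_k _ _
  le_sup_right x y := w_k _ _
  sup_le x y z h h' := by
    show (neg x.1 ⇾ y.1) ⇾ z.1 = one
    have h1 : neg z.1 ⇾ neg x.1 = one := by rw [← w_contra]; exact h
    have h2 := w_trans (w_mono (neg x.1) h') (w_anti z.1 h1)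
    rwa [bool_neg_imp z.2] at h2
  inf x y := ⟨odot x.1 y.1, bool_odot x.2 y.2⟩
  inf_le_left x y := by
    show odot x.1 y.1 ⇾ x.1 = one
    rw [odot_imp]; exact w_k _ _
  inf_le_right x y := by
    show odot x.1 y.1 ⇾ y.1 = one
    rw [odot_imp, w_refl, w_top]
  le_inf x y z h h' := by
    show x.1 ⇾ odot y.1 z.1 = one
    have := odot_mono h h'
    rwa [x.2] at this
  top := ⟨one, bool_one⟩
  le_top x := w_top _
  himp x y := ⟨x.1 ⇾ y.1, bool_imp x.2 y.2⟩
  le_himp_iff x y z := by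
    show x.1 ⇾ y.1 ⇾ z.1 = one ↔ odot x.1 y.1 ⇾ z.1 = one
    rw [odot_imp]
  bot := ⟨neg one, bool_neg bool_one⟩
  bot_le x := w_bot _
  compl x := ⟨neg x.1, bool_neg x.2⟩
  himp_bot x := Subtype.ext (w_neg_eq _).symm

instance : BooleanAlgebra (BoolPart A) :=
  BooleanAlgebra.ofRegular fun a => by
    have : a ⊔ aᶜ = ⊤ := Subtype.ext (w_refl (neg a.1))
    rw [this]; exact Heyting.isRegular_top

theorem boolPart_le {x y : BoolPart A} : x ≤ y ↔ x.1 ⇾ y.1 = one := Iff.rfl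

theorem boolPart_sup_val (x y : BoolPart A) : (x ⊔ y).1 = join x.1 y.1 := by
  refine w_antisymm (y := (x.1 ⇾ y.1) ⇾ y.1) ?_ ?_
  · have h : x ⊔ y ≤ (x ⇨ y) ⇨ y :=
      sup_le (w_le_join_left x.1 y.1) (w_le_join_right x.1 y.1)
    exact h
  · have h : xᶜ ≤ x ⇨ y := by rw [himp_eq]; exact le_sup_right
    exact w_anti y.1 h

end BoolPart

/-! ### Implicative filters and quotients -/

section Filters

variable {A : Type u} [WajsbergAlgebra A]

structure IsImplicativeFilter (F : Set A) : Prop where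
  one_mem : one ∈ F
  mp : ∀ a b, a ∈ F → a ⇾ b ∈ F → b ∈ F

/-- Prime implicative filters: the proper ones that are prime as lattice filters. -/
structure IsPrimeFilter (P : Set A) : Prop where
  implicative : IsImplicativeFilter P
  ne_univ : P ≠ Set.univ
  prime : ∀ x y, join x y ∈ P → x ∈ P ∨ y ∈ P

theorem IsImplicativeFilter.of_le {F : Set A} (hF : IsImplicativeFilter F) {a b : A}
    (ha : a ∈ F) (h : a ⇾ b = one) : b ∈ F :=
  hF.mp a b ha (h ▸ hF.one_mem)

/-- The congruence of an implicative filter. -/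
def filterSetoid {F : Set A} (hF : IsImplicativeFilter F) : Setoid A where
  r x y := x ⇾ y ∈ F ∧ y ⇾ x ∈ F
  iseqv :=
    { refl := fun x => by rw [w_refl]; exact ⟨hF.one_mem, hF.one_mem⟩
      symm := fun h => ⟨h.2, h.1⟩
      trans := fun {x y z} h h' =>
        ⟨hF.mp _ _ h'.1 (hF.of_le h.1 (imp_trans x y z)),
          hF.mp _ _ h.2 (hF.of_le h'.2 (imp_trans z y x))⟩ }

/-- The quotient `A/F`. -/
def FilterQuotient {F : Set A} (hF : IsImplicativeFilter F) : Type u := Quotient (filterSetoid hF)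

instance {F : Set A} (hF : IsImplicativeFilter F) : WajsbergAlgebra (FilterQuotient hF) where
  imp := Quotient.map₂ (sa := filterSetoid hF) (sb := filterSetoid hF) (sc := filterSetoid hF)
    (fun x y => x ⇾ y) (by
      intro x x' hx y y' hy
      refine (filterSetoid hF).iseqv.trans (y := x' ⇾ y) ?_ ?_
      · exact ⟨hF.of_le hx.2 (imp_trans _ _ _), hF.of_le hx.1 (imp_trans _ _ _)⟩
      · exact ⟨hF.of_le hy.1 (w_mono_trans _ _ _), hF.of_le hy.2 (w_mono_trans _ _ _)⟩)
  neg := Quotient.map (sa := filterSetoid hF) (sb := filterSetoid hF) neg (by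
      intro x y h
      refine ⟨?_, ?_⟩
      · rw [← w_contra]; exact h.2
      · rw [← w_contra]; exact h.1)
  one := Quotient.mk (filterSetoid hF) one
  one_imp x := Quotient.inductionOn x fun x =>
    congrArg (Quotient.mk (filterSetoid hF)) (one_imp x)
  imp_trans x y z := Quotient.inductionOn₃ x y z fun x y z =>
    congrArg (Quotient.mk (filterSetoid hF)) (imp_trans x y z)
  imp_comm x y := Quotient.inductionOn₂ x y fun x y =>
    congrArg (Quotient.mk (filterSetoid hF)) (imp_comm x y)
  neg_imp_neg x y := Quotient.inductionOn₂ x y fun x y =>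
    congrArg (Quotient.mk (filterSetoid hF)) (neg_imp_neg x y)

/-- The quotient map `A → A/F`. -/
def quotientMap {F : Set A} (hF : IsImplicativeFilter F) : WHom A (FilterQuotient hF) where
  toFun := Quotient.mk (filterSetoid hF)
  map_imp _ _ := rfl
  map_neg _ := rfl
  map_one := rfl

end Filters

/-! ### The chains `L_{n+1}` and `(n+1)`-valued Wajsberg algebras -/

/-- The Wajsberg algebra `[0,1]`. -/
noncomputable instance : WajsbergAlgebra unitInterval where
  imp x y := ⟨min 1 (1 - (x : ℝ) + y), by
    have := x.2.2; have := y.2.1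
    exact ⟨le_min zero_le_one (by linarith), min_le_left _ _⟩⟩
  neg x := ⟨1 - (x : ℝ), by have := x.2.2; have := x.2.1; constructor <;> linarith⟩
  one := 1
  one_imp x := by
    have := x.2.2
    apply Subtype.ext
    simp [this]
  imp_trans x y z := by
    have := x.2.2; have := x.2.1; have := y.2.2; have := y.2.1; have := z.2.2; have := z.2.1
    apply Subtype.ext
    show min 1 (1 - min 1 (1 - (x : ℝ) + y) + min 1 (1 - min 1 (1 - (y : ℝ) + z)
      + min 1 (1 - (x : ℝ) + z))) = 1
    simp only [min_def]; split_ifs <;> linarith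
  imp_comm x y := by
    have := x.2.2; have := x.2.1; have := y.2.2; have := y.2.1
    apply Subtype.ext
    show min 1 (1 - min 1 (1 - (x : ℝ) + y) + y) = min 1 (1 - min 1 (1 - (y : ℝ) + x) + x)
    simp only [min_def]; split_ifs <;> linarith
  neg_imp_neg x y := by
    have := x.2.2; have := x.2.1; have := y.2.2; have := y.2.1
    apply Subtype.ext
    show min 1 (1 - min 1 (1 - (1 - (y : ℝ)) + (1 - (x : ℝ))) + min 1 (1 - (x : ℝ) + y)) = 1
    simp only [min_def]; split_ifs <;> linarith

/-- The universe `{0, 1/n, …, (n-1)/n, 1}` of the subalgebra `L_{n+1}` of `[0,1]`. -/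
def chain (n : ℕ) : Set unitInterval := {x | ∃ k : ℕ, k ≤ n ∧ (x : ℝ) = k / n}

/-- Terms in the language of Wajsberg algebras, with variables indexed by `ℕ`. -/
inductive WTerm : Type
  | var : ℕ → WTerm
  | imp : WTerm → WTerm → WTerm
  | neg : WTerm → WTerm
  | one : WTerm

/-- The value of a term under a valuation of the variables. -/
def WTerm.eval {A : Type u} [WajsbergAlgebra A] (v : ℕ → A) : WTerm → A
  | .var i => v i
  | .imp s t => s.eval v ⇾ t.eval v
  | .neg s => WajsbergAlgebra.neg (s.eval v)
  | .one => WajsbergAlgebra.one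

/-- `A` is `(n+1)`-valued if it belongs to the variety generated by `L_{n+1}`, that is, if it
satisfies every identity `s = t` that holds in `L_{n+1}`. -/
def IsNValued (n : ℕ) (A : Type u) [WajsbergAlgebra A] : Prop :=
  ∀ s t : WTerm,
    (∀ v : ℕ → unitInterval, (∀ i, v i ∈ chain n) → s.eval v = t.eval v) →
      ∀ v : ℕ → A, s.eval v = t.eval v

/-- `C ⊆ L_{d+1}` up to isomorphism: there is an injective homomorphism from `C` to `[0,1]` with
values in the subalgebra `L_{d+1}`. -/
def EmbedsInChain (d : ℕ) (C : Type u) [WajsbergAlgebra C] : Prop :=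
  ∃ f : WHom C unitInterval, Function.Injective f.toFun ∧ ∀ x, f.toFun x ∈ chain d

/-- `P_d = ⋂ {P ∈ χ(A) : A/P ⊆ L_{d+1}}`, where `χ(A)` is the set of prime implicative filters. -/
def primeInter (A : Type u) [WajsbergAlgebra A] (d : ℕ) : Set A :=
  {x | ∀ (P : Set A) (hP : IsPrimeFilter P),
    EmbedsInChain d (FilterQuotient hP.implicative) → x ∈ P}

theorem primeInter_implicative (A : Type u) [WajsbergAlgebra A] (d : ℕ) :
    IsImplicativeFilter (primeInter A d) where
  one_mem _ hP _ := hP.implicative.one_mem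
  mp a b ha hab P hP h := hP.implicative.mp a b (ha P hP h) (hab P hP h)

/-- The filter `h_A(d) = P_d ∩ B(A)` of `B(A)`. -/
def boolFilter (A : Type u) [WajsbergAlgebra A] (d : ℕ) : Order.PFilter (BoolPart A) :=
  Order.IsPFilter.toPFilter (F := {b : BoolPart A | b.1 ∈ primeInter A d})
    (Order.IsPFilter.of_def ⟨⊤, (primeInter_implicative A d).one_mem⟩
      (fun x hx y hy => ⟨x ⊓ y, by
        refine (primeInter_implicative A d).mp _ _ hy
          ((primeInter_implicative A d).of_le hx ?_)
        show x.1 ⇾ y.1 ⇾ odot x.1 y.1 = one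
        rw [← odot_imp, w_refl], inf_le_left, inf_le_right⟩)
      (fun h hx => (primeInter_implicative A d).of_le hx h))

theorem mem_boolFilter {A : Type u} [WajsbergAlgebra A] {d : ℕ} {b : BoolPart A} :
    b ∈ boolFilter A d ↔ b.1 ∈ primeInter A d := Iff.rfl

section Homs

variable {A : Type u} [WajsbergAlgebra A]

theorem unit_imp_val (x y : unitInterval) : ((x ⇾ y : unitInterval) : ℝ) = min 1 (1 - (x : ℝ) + y) :=
  rfl

theorem unit_neg_val (x : unitInterval) : ((neg x : unitInterval) : ℝ) = 1 - (x : ℝ) := rfl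

theorem unit_one_val : ((one : unitInterval) : ℝ) = 1 := rfl

theorem unit_imp_eq_one {x y : unitInterval} : x ⇾ y = one ↔ (x : ℝ) ≤ y := by
  rw [Subtype.ext_iff, unit_imp_val, unit_one_val, min_eq_left_iff]
  constructor <;> intro h <;> linarith

theorem unit_eq_one {x : unitInterval} : x = one ↔ 1 ≤ (x : ℝ) := by
  rw [Subtype.ext_iff, unit_one_val]
  exact ⟨fun h => h.ge, fun h => le_antisymm x.2.2 h⟩

theorem kernel_prime (g : WHom A unitInterval) : IsPrimeFilter {x | g.toFun x = one} where
  implicative :=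
    { one_mem := g.map_one
      mp := fun a b (ha : g.toFun a = one) (hab : g.toFun (a ⇾ b) = one) => by
        rw [g.map_imp, ha, one_imp] at hab; exact hab }
  ne_univ h := by
    have h1 : g.toFun (neg one) = one := by
      have : neg one ∈ {x | g.toFun x = one} := h ▸ Set.mem_univ _
      exact this
    rw [g.map_neg, g.map_one, Subtype.ext_iff, unit_neg_val, unit_one_val] at h1
    norm_num at h1
  prime x y h := by
    rw [Set.mem_ofPred_eq, join, g.map_imp, g.map_imp, unit_imp_eq_one, unit_imp_val] at h
    rcases le_total (g.toFun x : ℝ) (g.toFun y) with h' | h'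
    · right
      rw [Set.mem_ofPred_eq, unit_eq_one]
      rwa [min_eq_left (by linarith)] at h
    · left
      rw [Set.mem_ofPred_eq, unit_eq_one]
      rw [min_eq_right (by linarith)] at h
      linarith

theorem kernel_embeds (g : WHom A unitInterval) {d : ℕ} (hg : ∀ x, g.toFun x ∈ chain d) :
    EmbedsInChain d (FilterQuotient (kernel_prime g).implicative) := by
  have key : ∀ x y, g.toFun (x ⇾ y) = one ∧ g.toFun (y ⇾ x) = one ↔ g.toFun x = g.toFun y := by
    intro x y
    rw [g.map_imp, g.map_imp, unit_imp_eq_one, unit_imp_eq_one, Subtype.ext_iff]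
    exact le_antisymm_iff.symm
  refine ⟨⟨Quotient.lift (s := filterSetoid _) g.toFun fun x y h => (key x y).1 h, ?_, ?_,
    g.map_one⟩, ?_, ?_⟩
  · intro x y
    exact Quotient.inductionOn₂ x y fun x y => g.map_imp x y
  · intro x
    exact Quotient.inductionOn x fun x => g.map_neg x
  · intro x y
    exact Quotient.inductionOn₂ x y fun x y h => Quotient.sound ((key x y).2 h)
  · intro x
    exact Quotient.inductionOn x hg

theorem mem_primeInter_iff {d : ℕ} {x : A} :
    x ∈ primeInter A d ↔
      ∀ g : WHom A unitInterval, (∀ y, g.toFun y ∈ chain d) → g.toFun x = one := by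
  constructor
  · intro h g hg
    exact h _ (kernel_prime g) (kernel_embeds g hg)
  · rintro h P hP ⟨f, hf, hfd⟩
    let q := quotientMap hP.implicative
    have h1 := h ⟨fun x => f.toFun (q.toFun x), fun x y => by rw [q.map_imp, f.map_imp],
      fun x => by rw [q.map_neg, f.map_neg], by rw [q.map_one, f.map_one]⟩ fun y => hfd _
    have h2 : q.toFun x = q.toFun one := hf (h1.trans (by rw [q.map_one, f.map_one]))
    have h3 := (Quotient.exact h2 : x ⇾ one ∈ P ∧ one ⇾ x ∈ P).2
    rwa [one_imp] at h3

/-! ### Homomorphisms into `L_{n+1}` separate implicative filters from points -/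

theorem one_mem_chain {n : ℕ} [NeZero n] : (one : unitInterval) ∈ chain n :=
  ⟨n, le_rfl, by rw [unit_one_val, div_self (NeZero.ne (n : ℝ))]⟩

/-- `t → (t → ⋯ (t → s))`, with `k` occurrences of `t`. -/
def WTerm.iter (t : WTerm) : ℕ → WTerm → WTerm
  | 0, s => s
  | k + 1, s => .imp t (t.iter k s)

theorem iter_mem {F : Set A} (hF : IsImplicativeFilter F) {v : ℕ → A} {t s : WTerm}
    (ht : t.eval v ∈ F) : ∀ k, (t.iter k s).eval v ∈ F → s.eval v ∈ F
  | 0, h => h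
  | k + 1, h => iter_mem hF ht k (hF.mp _ _ ht h)

theorem iter_eval_one {v : ℕ → A} {t s : WTerm} (hs : s.eval v = one) :
    ∀ k, (t.iter k s).eval v = one
  | 0 => hs
  | k + 1 => by
    show t.eval v ⇾ (t.iter k s).eval v = one
    rw [iter_eval_one hs k, w_top]

theorem iter_val {v : ℕ → unitInterval} {t s : WTerm} :
    ∀ k : ℕ, min 1 (k * (1 - ((t.eval v : unitInterval) : ℝ))) ≤ (((t.iter k s).eval v : unitInterval) : ℝ)
  | 0 => by
    have := (s.eval v).2.1
    simp [WTerm.iter, this]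
  | k + 1 => by
    have h := iter_val (v := v) (t := t) (s := s) k
    have h1 := (t.eval v).2.2
    show _ ≤ ((t.eval v ⇾ (t.iter k s).eval v : unitInterval) : ℝ)
    rw [unit_imp_val]
    push_cast
    rcases min_le_iff.1 h with h | h
    · rw [min_eq_left (b := 1 - _ + _) (by linarith)]; exact min_le_left _ _
    · exact min_le_min le_rfl (by linarith)

theorem chain_iter {n : ℕ} [NeZero n] {v : ℕ → unitInterval} {t s : WTerm}
    (h : t.eval v ∈ chain n) (h1 : t.eval v ≠ one) : (t.iter n s).eval v = one := by
  obtain ⟨k, hk, e⟩ := h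
  have hn : (0 : ℝ) < n := by exact_mod_cast NeZero.pos n
  have hkn : (k : ℝ) + 1 ≤ n := by
    rcases hk.lt_or_eq with h | h
    · exact_mod_cast h
    · exfalso; apply h1
      rw [Subtype.ext_iff, e, h, div_self hn.ne', unit_one_val]
  rw [unit_eq_one]
  refine le_trans (le_min le_rfl ?_) (iter_val n)
  rw [e, mul_sub, mul_one, mul_div_cancel₀ _ hn.ne']
  linarith

theorem chain_imp {n : ℕ} [NeZero n] {x y : unitInterval} (hx : x ∈ chain n) (hy : y ∈ chain n) :
    x ⇾ y ∈ chain n := by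
  obtain ⟨k, hk, e⟩ := hx
  obtain ⟨l, hl, e'⟩ := hy
  have hn : (n : ℝ) ≠ 0 := NeZero.ne (n : ℝ)
  refine ⟨min n (n - k + l), min_le_left _ _, ?_⟩
  rw [unit_imp_val, e, e', Nat.cast_min, Nat.cast_add, Nat.cast_sub hk,
    ← min_div_div_right (Nat.cast_nonneg n), div_self hn]
  congr 1
  field_simp

theorem chain_neg {n : ℕ} [NeZero n] {x : unitInterval} (hx : x ∈ chain n) :
    neg x ∈ chain n := by
  obtain ⟨k, hk, e⟩ := hx
  have hn : (n : ℝ) ≠ 0 := NeZero.ne (n : ℝ)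
  refine ⟨n - k, Nat.sub_le _ _, ?_⟩
  rw [unit_neg_val, e, Nat.cast_sub hk]
  field_simp

theorem chain_eval {n : ℕ} [NeZero n] {v : ℕ → unitInterval} (hv : ∀ i, v i ∈ chain n) :
    ∀ t : WTerm, t.eval v ∈ chain n
  | .var i => hv i
  | .imp s t => chain_imp (chain_eval hv s) (chain_eval hv t)
  | .neg s => chain_neg (chain_eval hv s)
  | .one => one_mem_chain

/-- A quasi-identity valid in `L_{n+1}` is valid, modulo `F`, in every `(n+1)`-valued algebra. -/
theorem nvalued_quasi {n : ℕ} [NeZero n] (hA : IsNValued n A) {F : Set A}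
    (hF : IsImplicativeFilter F) (T : List WTerm) (a : WTerm)
    (h : ∀ v : ℕ → unitInterval, (∀ i, v i ∈ chain n) → (∀ t ∈ T, t.eval v = one) →
      a.eval v = one)
    (u : ℕ → A) (hu : ∀ t ∈ T, t.eval u ∈ F) : a.eval u ∈ F := by
  induction T generalizing a with
  | nil =>
    have := hA a .one (fun v hv => h v hv (by simp)) u
    rw [this]; exact hF.one_mem
  | cons t T ih =>
    refine iter_mem hF (hu t (by simp)) n (ih (t.iter n a) ?_ fun s hs => hu s (by simp [hs]))
    intro v hv hT
    by_cases ht : t.eval v = one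
    · exact iter_eval_one (h v hv (by simpa [ht] using hT)) n
    · exact chain_iter (chain_eval hv t) ht

theorem chain_finite (n : ℕ) : (chain n).Finite := by
  refine Set.Finite.of_finite_image (f := (Subtype.val : unitInterval → ℝ)) ?_
    Subtype.val_injective.injOn
  refine ((Set.finite_Iic n).image fun k : ℕ => (k : ℝ) / n).subset ?_
  rintro _ ⟨x, ⟨k, hk, e⟩, rfl⟩
  exact ⟨k, hk, e.symm⟩

theorem continuous_unit_imp : Continuous fun p : unitInterval × unitInterval => p.1 ⇾ p.2 := by
  refine Continuous.subtype_mk (f := fun p : unitInterval × unitInterval =>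
    min 1 (1 - (p.1 : ℝ) + p.2)) ?_ _
  fun_prop

theorem continuous_unit_neg : Continuous fun p : unitInterval => neg p := by
  refine Continuous.subtype_mk (f := fun p : unitInterval => 1 - (p : ℝ)) ?_ _
  fun_prop

theorem exists_hom {n : ℕ} [NeZero n] (hA : IsNValued n A) {F : Set A}
    (hF : IsImplicativeFilter F) {a : A} (ha : a ∉ F) :
    ∃ g : WHom A unitInterval, (∀ x, g.toFun x ∈ chain n) ∧ (∀ x ∈ F, g.toFun x = one) ∧
      g.toFun a ≠ one := by
  classical
  let C : Finset A → Set (A → unitInterval) := fun S =>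
    {g | (∀ x, g x ∈ chain n) ∧ (∀ x ∈ S, ∀ y ∈ S, x ⇾ y ∈ S → g (x ⇾ y) = g x ⇾ g y) ∧
      (∀ x ∈ S, neg x ∈ S → g (neg x) = neg (g x)) ∧ (∀ x ∈ S, x ∈ F → g x = one) ∧
      g a ∈ chain n \ {one}}
  have hmono : ∀ S T : Finset A, S ⊆ T → C T ⊆ C S := fun S T h g hg =>
    ⟨hg.1, fun x hx y hy hxy => hg.2.1 x (h hx) y (h hy) (h hxy),
      fun x hx hx' => hg.2.2.1 x (h hx) (h hx'), fun x hx => hg.2.2.2.1 x (h hx), hg.2.2.2.2⟩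
  have hclosed : ∀ S, IsClosed (C S) := by
    intro S
    have e : C S = (⋂ x, {g | g x ∈ chain n}) ∩ ((⋂ x ∈ S, ⋂ y ∈ S, ⋂ (_ : x ⇾ y ∈ S),
        {g | g (x ⇾ y) = g x ⇾ g y}) ∩ ((⋂ x ∈ S, ⋂ (_ : neg x ∈ S), {g | g (neg x) = neg (g x)}) ∩
        ((⋂ x ∈ S, ⋂ (_ : x ∈ F), {g | g x = one}) ∩ {g | g a ∈ chain n \ {one}}))) := by
      ext g
      simp only [C, Set.mem_ofPred_eq, Set.mem_inter_iff, Set.mem_iInter]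
    rw [e]
    refine (isClosed_iInter fun x => (chain_finite n).isClosed.preimage (continuous_apply x)).inter
      (IsClosed.inter ?_ (IsClosed.inter ?_ (IsClosed.inter ?_ ?_)))
    · refine isClosed_iInter fun x => isClosed_iInter fun _ => isClosed_iInter fun y =>
        isClosed_iInter fun _ => isClosed_iInter fun _ => isClosed_eq (continuous_apply _) ?_
      have h : Continuous fun g : A → unitInterval => (g x, g y) := by fun_prop
      exact continuous_unit_imp.comp h
    · refine isClosed_iInter fun x => isClosed_iInter fun _ => isClosed_iInter fun _ =>
        isClosed_eq (continuous_apply _) ?_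
      exact continuous_unit_neg.comp (continuous_apply x)
    · exact isClosed_iInter fun x => isClosed_iInter fun _ => isClosed_iInter fun _ =>
        isClosed_eq (continuous_apply _) continuous_const
    · exact ((chain_finite n).subset Set.sdiff_subset).isClosed.preimage (continuous_apply a)
  have hne : ∀ S, (C S).Nonempty := by
    intro S
    obtain ⟨c, hc⟩ : ∃ c : A → ℕ, Set.InjOn c (insert a S : Finset A) :=
      Set.countable_iff_exists_injOn.1 (insert a S : Finset A).countable_toSet
    have ha' : a ∈ (insert a S : Finset A) := by simp
    have hS : ∀ x ∈ S, x ∈ (insert a S : Finset A) := fun x hx => by simp [hx]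
    let u : ℕ → A := fun i => if h : ∃ x ∈ (insert a S : Finset A), c x = i then h.choose else one
    have hu : ∀ x ∈ (insert a S : Finset A), u (c x) = x := by
      intro x hx
      have h : ∃ y ∈ (insert a S : Finset A), c y = c x := ⟨x, hx, rfl⟩
      simp only [u, dif_pos h]
      exact hc h.choose_spec.1 hx h.choose_spec.2
    let V : A → WTerm := fun x => .var (c x)
    let T : Finset WTerm :=
      ((S ×ˢ S).filter fun p => p.1 ⇾ p.2 ∈ S).image
          (fun p => .imp (.imp (V p.1) (V p.2)) (V (p.1 ⇾ p.2))) ∪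
        (((S ×ˢ S).filter fun p => p.1 ⇾ p.2 ∈ S).image
          (fun p => .imp (V (p.1 ⇾ p.2)) (.imp (V p.1) (V p.2))) ∪
        ((S.filter fun x => neg x ∈ S).image (fun x => .imp (.neg (V x)) (V (neg x))) ∪
        ((S.filter fun x => neg x ∈ S).image (fun x => .imp (V (neg x)) (.neg (V x))) ∪
        (S.filter fun x => x ∈ F).image V)))
    have hT : ∀ t ∈ T, t.eval u ∈ F := by
      intro t ht
      simp only [T, Finset.mem_union, Finset.mem_image, Finset.mem_filter, Finset.mem_product] at ht
      rcases ht with ⟨p, ⟨⟨h1, h2⟩, h3⟩, rfl⟩ | ⟨p, ⟨⟨h1, h2⟩, h3⟩, rfl⟩ | ⟨x, ⟨h1, h2⟩, rfl⟩ |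
        ⟨x, ⟨h1, h2⟩, rfl⟩ | ⟨x, ⟨h1, h2⟩, rfl⟩
      · simp only [V, WTerm.eval, hu _ (hS _ h1), hu _ (hS _ h2), hu _ (hS _ h3), w_refl]
        exact hF.one_mem
      · simp only [V, WTerm.eval, hu _ (hS _ h1), hu _ (hS _ h2), hu _ (hS _ h3), w_refl]
        exact hF.one_mem
      · simp only [V, WTerm.eval, hu _ (hS _ h1), hu _ (hS _ h2), w_refl]
        exact hF.one_mem
      · simp only [V, WTerm.eval, hu _ (hS _ h1), hu _ (hS _ h2), w_refl]
        exact hF.one_mem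
      · simp only [V, WTerm.eval, hu _ (hS _ h1)]
        exact h2
    by_contra hemp
    apply ha
    have := nvalued_quasi hA hF T.toList (V a) ?_ u fun t ht => hT t (Finset.mem_toList.1 ht)
    · simpa only [V, WTerm.eval, hu _ ha'] using this
    intro v hv hvT
    by_contra hva
    refine hemp ⟨fun x => v (c x), fun x => hv _, fun x hx y hy hxy => ?_, fun x hx hx' => ?_,
      fun x hx hx' => ?_, hv _, hva⟩
    · refine w_antisymm ?_ ?_
      · refine hvT (.imp (V (x ⇾ y)) (.imp (V x) (V y))) (Finset.mem_toList.2 ?_)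
        simp only [T, Finset.mem_union]
        exact .inr (.inl (Finset.mem_image.2 ⟨(x, y), by simp [hx, hy, hxy], rfl⟩))
      · refine hvT (.imp (.imp (V x) (V y)) (V (x ⇾ y))) (Finset.mem_toList.2 ?_)
        simp only [T, Finset.mem_union]
        exact .inl (Finset.mem_image.2 ⟨(x, y), by simp [hx, hy, hxy], rfl⟩)
    · refine w_antisymm ?_ ?_
      · refine hvT (.imp (V (neg x)) (.neg (V x))) (Finset.mem_toList.2 ?_)
        simp only [T, Finset.mem_union]
        exact .inr (.inr (.inr (.inl (Finset.mem_image.2 ⟨x, by simp [hx, hx'], rfl⟩))))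
      · refine hvT (.imp (.neg (V x)) (V (neg x))) (Finset.mem_toList.2 ?_)
        simp only [T, Finset.mem_union]
        exact .inr (.inr (.inl (Finset.mem_image.2 ⟨x, by simp [hx, hx'], rfl⟩)))
    · refine hvT (V x) (Finset.mem_toList.2 ?_)
      simp only [T, Finset.mem_union]
      exact .inr (.inr (.inr (.inr (Finset.mem_image.2 ⟨x, by simp [hx, hx'], rfl⟩))))
  obtain ⟨g, hg⟩ := IsCompact.nonempty_iInter_of_directed_nonempty_isCompact_isClosed C
    (fun S T => ⟨S ∪ T, hmono _ _ Finset.subset_union_left, hmono _ _ Finset.subset_union_right⟩)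
    hne (fun S => (hclosed S).isCompact) hclosed
  rw [Set.mem_iInter] at hg
  refine ⟨⟨g, fun x y => ?_, fun x => ?_, ?_⟩, (hg ∅).1, fun x hx => ?_, (hg ∅).2.2.2.2.2⟩
  · exact (hg {x, y, x ⇾ y}).2.1 x (by simp) y (by simp) (by simp)
  · exact (hg {x, neg x}).2.2.1 x (by simp) (by simp)
  · exact (hg {one}).2.2.2.1 one (by simp) hF.one_mem
  · exact (hg {x}).2.2.2.1 x (by simp) hx

end Homs

/-! ### The properties of `h_A` -/

section Properties

variable {A : Type u} [WajsbergAlgebra A]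

theorem singleton_one_implicative : IsImplicativeFilter ({one} : Set A) where
  one_mem := rfl
  mp a b ha hab := by
    rw [Set.mem_singleton_iff] at *
    rwa [ha, one_imp] at hab

theorem boolFilter_self {n : ℕ} [NeZero n] (hA : IsNValued n A) :
    (boolFilter A n : Set (BoolPart A)) = {⊤} := by
  ext b
  rw [SetLike.mem_coe, mem_boolFilter, mem_primeInter_iff, Set.mem_singleton_iff]
  constructor
  · intro h
    by_contra hb
    obtain ⟨g, hg, -, hgb⟩ := exists_hom hA singleton_one_implicative (a := b.1)
      (fun h' => hb (Subtype.ext h'))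
    exact hgb (h g hg)
  · rintro rfl g _
    exact g.map_one

theorem mem_chain_iff {d : ℕ} (hd : 0 < d) {x : unitInterval} :
    x ∈ chain d ↔ ∃ z : ℤ, (x : ℝ) * d = z := by
  have hd' : (0 : ℝ) < d := by exact_mod_cast hd
  constructor
  · rintro ⟨k, -, e⟩
    exact ⟨k, by rw [e, div_mul_cancel₀ _ hd'.ne']; simp⟩
  · rintro ⟨z, e⟩
    have h0 : (0 : ℝ) ≤ z := e ▸ mul_nonneg x.2.1 hd'.le
    have h1 : (z : ℝ) ≤ d := by
      have := mul_le_mul_of_nonneg_right x.2.2 hd'.le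
      rwa [e, one_mul] at this
    obtain ⟨k, rfl⟩ := Int.eq_ofNat_of_zero_le (by exact_mod_cast h0)
    refine ⟨k, by exact_mod_cast h1, ?_⟩
    rw [eq_div_iff hd'.ne', e]; simp

theorem chain_mono {d r : ℕ} (hr : 0 < r) (h : d ∣ r) : chain d ⊆ chain r := by
  intro x hx
  obtain ⟨c, rfl⟩ := h
  obtain ⟨z, hz⟩ := (mem_chain_iff (Nat.pos_of_mul_pos_right hr)).1 hx
  refine (mem_chain_iff hr).2 ⟨z * c, ?_⟩
  push_cast
  rw [← mul_assoc, hz]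

theorem chain_gcd {d r : ℕ} (hd : 0 < d) (hr : 0 < r) {x : unitInterval} (h : x ∈ chain d)
    (h' : x ∈ chain r) : x ∈ chain (d.gcd r) := by
  obtain ⟨z, hz⟩ := (mem_chain_iff hd).1 h
  obtain ⟨z', hz'⟩ := (mem_chain_iff hr).1 h'
  refine (mem_chain_iff (Nat.gcd_pos_of_pos_left _ hd)).2 ⟨z * d.gcdA r + z' * d.gcdB r, ?_⟩
  have := congrArg (Int.cast : ℤ → ℝ) (Nat.gcd_eq_gcd_ab d r)
  push_cast at this ⊢
  rw [this, ← hz, ← hz']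
  ring

/-- The term function `x ↦ max 0 (min 1 (m * x - i + 1))`. -/
def trunc (x : A) : ℕ → ℕ → A
  | _, 0 => one
  | 0, _ + 1 => neg one
  | m + 1, i + 1 => odot (neg (trunc x m (i + 1)) ⇾ x) (trunc x m i)

theorem map_trunc {B : Type v} [WajsbergAlgebra B] (g : WHom A B) (x : A) :
    ∀ m i, g.toFun (trunc x m i) = trunc (g.toFun x) m i
  | 0, 0 => g.map_one
  | _ + 1, 0 => g.map_one
  | 0, i + 1 => by simp only [trunc, g.map_neg, g.map_one]
  | m + 1, i + 1 => by
    simp only [trunc, odot, g.map_neg, g.map_imp, map_trunc g x m i, map_trunc g x m (i + 1)]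

theorem trunc_val (x : unitInterval) :
    ∀ m i : ℕ, ((trunc x m i : unitInterval) : ℝ) = max 0 (min 1 (m * (x : ℝ) - i + 1))
  | 0, 0 => by simp [trunc, unit_one_val]
  | m + 1, 0 => by
    have := mul_nonneg (Nat.cast_nonneg (α := ℝ) (m + 1)) x.2.1
    simp only [trunc, unit_one_val, Nat.cast_zero, sub_zero]
    rw [min_eq_left (by linarith), max_eq_right zero_le_one]
  | 0, i + 1 => by
    simp [trunc, unit_neg_val, unit_one_val]
  | m + 1, i + 1 => by
    have h0 := x.2.1
    have h1 := x.2.2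
    simp only [trunc, odot, unit_neg_val, unit_imp_val, trunc_val x m i, trunc_val x m (i + 1)]
    push_cast
    rw [add_one_mul (m : ℝ) (x : ℝ)]
    generalize (m : ℝ) * x = y
    simp only [max_def, min_def]
    split_ifs <;> linarith

/-- The Boolean-valued term function of `L_{n+1}` that vanishes exactly at `k/n`. -/
def avoid (n k : ℕ) (x : A) : A := trunc x n k ⇾ trunc x n (k + 1)

theorem avoid_chain {n k l : ℕ} [NeZero n] {x : unitInterval} (hx : (x : ℝ) = l / n) :
    avoid n k x = if l = k then neg one else one := by
  have hn : (n : ℝ) ≠ 0 := NeZero.ne (n : ℝ)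
  have e : (n : ℝ) * x = l := by rw [hx]; field_simp
  apply Subtype.ext
  rw [avoid, unit_imp_val, trunc_val, trunc_val, e]
  push_cast
  rcases lt_trichotomy l k with h | h | h
  · have h' : (l : ℝ) + 1 ≤ k := by exact_mod_cast h
    rw [if_neg h.ne, unit_one_val, min_eq_left]
    simp only [max_def, min_def]
    split_ifs <;> linarith
  · subst h
    rw [if_pos rfl, unit_neg_val, unit_one_val]
    simp
  · have h' : (k : ℝ) + 1 ≤ l := by exact_mod_cast h
    rw [if_neg h.ne', unit_one_val, min_eq_left]
    simp only [max_def, min_def]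
    split_ifs <;> linarith

theorem map_odot {B : Type v} [WajsbergAlgebra B] (g : WHom A B) (x y : A) :
    g.toFun (odot x y) = odot (g.toFun x) (g.toFun y) := by
  simp only [odot, g.map_neg, g.map_imp]

theorem map_avoid {B : Type v} [WajsbergAlgebra B] (g : WHom A B) (n k : ℕ) (x : A) :
    g.toFun (avoid n k x) = avoid n k (g.toFun x) := by
  simp only [avoid, g.map_imp, map_trunc]

theorem hom_ext {n : ℕ} [NeZero n] (hA : IsNValued n A) {x y : A}
    (h : ∀ g : WHom A unitInterval, (∀ z, g.toFun z ∈ chain n) → g.toFun x = g.toFun y) :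
    x = y := by
  refine w_antisymm ?_ ?_ <;> by_contra hxy
  · obtain ⟨g, hg, -, hgb⟩ := exists_hom hA singleton_one_implicative hxy
    exact hgb (by rw [g.map_imp, h g hg, w_refl])
  · obtain ⟨g, hg, -, hgb⟩ := exists_hom hA singleton_one_implicative hxy
    exact hgb (by rw [g.map_imp, h g hg, w_refl])

theorem bool_avoid {n : ℕ} [NeZero n] (hA : IsNValued n A) (k : ℕ) (x : A) :
    odot (avoid n k x) (avoid n k x) = avoid n k x := by
  refine hom_ext hA fun g hg => ?_
  obtain ⟨l, -, hl⟩ := hg x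
  rw [map_odot, map_avoid, avoid_chain hl]
  split_ifs
  · exact bool_neg bool_one
  · exact bool_one

/-- A homomorphism into `L_{n+1}` whose kernel contains `h_A(d)` has its range in `L_{d+1}`. -/
theorem range_of_kernel {n : ℕ} [NeZero n] (hA : IsNValued n A) {d : ℕ} (hd : d ∣ n)
    (g : WHom A unitInterval) (hg : ∀ x, g.toFun x ∈ chain n)
    (h : ∀ b ∈ boolFilter A d, g.toFun b.1 = one) (x : A) : g.toFun x ∈ chain d := by
  by_contra hx
  obtain ⟨k, hk, e⟩ := hg x
  let b : BoolPart A := ⟨avoid n k x, bool_avoid hA k x⟩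
  have hb : g.toFun (avoid n k x) = one := h b (by
    rw [mem_boolFilter, mem_primeInter_iff]
    intro g' hg'
    show g'.toFun (avoid n k x) = one
    obtain ⟨l, -, el⟩ := chain_mono (NeZero.pos n) hd (hg' x)
    rw [map_avoid, avoid_chain el, if_neg]
    rintro rfl
    have : g.toFun x = g'.toFun x := Subtype.ext (e.trans el.symm)
    exact hx (this ▸ hg' x))
  rw [map_avoid, avoid_chain e, if_pos rfl, Subtype.ext_iff, unit_neg_val, unit_one_val] at hb
  norm_num at hb

theorem boolFilter_mono {d r : ℕ} (hr : 0 < r) (h : d ∣ r) : boolFilter A r ≤ boolFilter A d := by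
  intro b hb
  rw [mem_boolFilter, mem_primeInter_iff] at *
  exact fun g hg => hb g fun y => chain_mono hr h (hg y)

theorem boolFilter_gcd {n : ℕ} [NeZero n] (hA : IsNValued n A) {d r : ℕ} (hd : d ∣ n)
    (hr : r ∣ n) : IsLUB {boolFilter A d, boolFilter A r} (boolFilter A (d.gcd r)) := by
  have hd0 := Nat.pos_of_dvd_of_pos hd (NeZero.pos n)
  have hr0 := Nat.pos_of_dvd_of_pos hr (NeZero.pos n)
  constructor
  · rintro _ (rfl | rfl)
    · exact boolFilter_mono hd0 (Nat.gcd_dvd_left _ _)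
    · exact boolFilter_mono hr0 (Nat.gcd_dvd_right _ _)
  · intro F hF a ha
    have hFd : boolFilter A d ≤ F := hF (by simp)
    have hFr : boolFilter A r ≤ F := hF (by simp)
    let G : Set A := {x | ∃ b ∈ F, b.1 ⇾ x = one}
    have hG : IsImplicativeFilter G :=
      { one_mem := ⟨⊤, Order.PFilter.top_mem, w_refl _⟩
        mp := by
          rintro x y ⟨b, hb, hbx⟩ ⟨c, hc, hcy⟩
          refine ⟨b ⊓ c, Order.PFilter.inf_mem hb hc, ?_⟩
          have h1 : (b ⊓ c).1 ⇾ x = one := w_trans (boolPart_le.1 inf_le_left) hbx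
          have h2 : (b ⊓ c).1 ⇾ x ⇾ y = one := w_trans (boolPart_le.1 inf_le_right) hcy
          have h3 := w_trans h2 (w_anti y h1)
          rwa [bool_contract (b ⊓ c).2] at h3 }
    have hFG : ∀ b ∈ F, b.1 ∈ G := fun b hb => ⟨b, hb, w_refl _⟩
    by_contra haF
    obtain ⟨g, hg, hgG, hga⟩ := exists_hom hA hG (a := a.1) (by
      rintro ⟨b, hb, hba⟩
      exact haF (Order.PFilter.mem_of_le (boolPart_le.2 hba) hb))
    rw [mem_boolFilter, mem_primeInter_iff] at ha
    exact hga (ha g fun y => chain_gcd hd0 hr0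
      (range_of_kernel hA hd g hg (fun b hb => hgG _ (hFG _ (hFd hb))) y)
      (range_of_kernel hA hr g hg (fun b hb => hgG _ (hFG _ (hFr hb))) y))

end Properties

/-! ### The two categories -/

/-- The (positive) divisors of `n`. -/
abbrev Divisor (n : ℕ) : Type := {d : ℕ // d ∣ n}

def Divisor.gcd {n : ℕ} (d r : Divisor n) : Divisor n :=
  ⟨Nat.gcd d.1 r.1, (Nat.gcd_dvd_left _ _).trans d.2⟩

/-- The objects of the category of `(n+1)`-valued Wajsberg algebras. -/
structure WAlg (n : ℕ) where
  carrier : Type u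
  [str : WajsbergAlgebra carrier]
  nvalued : IsNValued n carrier

attribute [instance] WAlg.str

def WHom.id (A : Type u) [WajsbergAlgebra A] : WHom A A where
  toFun x := x
  map_imp _ _ := rfl
  map_neg _ := rfl
  map_one := rfl

def WHom.comp {A : Type u} {B : Type v} {C : Type w} [WajsbergAlgebra A] [WajsbergAlgebra B]
    [WajsbergAlgebra C] (f : WHom A B) (g : WHom B C) : WHom A C where
  toFun x := g.toFun (f.toFun x)
  map_imp x y := by rw [f.map_imp, g.map_imp]
  map_neg x := by rw [f.map_neg, g.map_neg]
  map_one := by rw [f.map_one, g.map_one]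

instance (n : ℕ) : Category.{u} (WAlg.{u} n) where
  Hom A B := WHom A.carrier B.carrier
  id A := WHom.id A.carrier
  comp f g := WHom.comp f g

/-- The pairs `⟨B, h⟩`, where `B` is a Boolean algebra and `h` assigns to each divisor of `n` a
(possibly improper) filter of `B`, such that `h(n) = {1}` and `h(gcd(d,r)) = h(d) ∨ h(r)` in the
lattice of filters of `B`. -/
structure BPair (n : ℕ) where
  carrier : Type u
  [str : BooleanAlgebra carrier]
  filt : Divisor n → Order.PFilter carrier
  filt_self : (filt ⟨n, dvd_rfl⟩ : Set carrier) = {⊤}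
  filt_gcd : ∀ d r : Divisor n, IsLUB {filt d, filt r} (filt (d.gcd r))

attribute [instance] BPair.str

/-- Boolean homomorphisms `θ` with `h₁(d) ⊆ θ⁻¹(h₂(d))` for every divisor `d` of `n`. -/
@[ext]
structure BPair.Hom {n : ℕ} (X Y : BPair.{u} n) where
  hom : BoundedLatticeHom X.carrier Y.carrier
  map_filt : ∀ d : Divisor n, (X.filt d : Set X.carrier) ⊆ hom ⁻¹' (Y.filt d : Set Y.carrier)

instance (n : ℕ) : Category.{u} (BPair.{u} n) where
  Hom X Y := BPair.Hom X Y
  id X := ⟨BoundedLatticeHom.id X.carrier, fun _ _ h => h⟩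
  comp f g := ⟨g.hom.comp f.hom, fun d _ h => g.map_filt d (f.map_filt d h)⟩

/-! ### The functor `A ↦ ⟨B(A), h_A⟩` -/

section FunctorB

variable {A : Type u} {C : Type v} [WajsbergAlgebra A] [WajsbergAlgebra C]

/-- The restriction of a homomorphism to the Boolean elements. -/
def boolMap (g : WHom A C) : BoundedLatticeHom (BoolPart A) (BoolPart C) where
  toFun b := ⟨g.toFun b.1, by rw [← map_odot, b.2]⟩
  map_sup' x y := Subtype.ext (by
    show g.toFun (neg x.1 ⇾ y.1) = neg (g.toFun x.1) ⇾ g.toFun y.1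
    rw [g.map_imp, g.map_neg])
  map_inf' x y := Subtype.ext (map_odot g x.1 y.1)
  map_top' := Subtype.ext g.map_one
  map_bot' := Subtype.ext (by
    show g.toFun (neg one) = neg one
    rw [g.map_neg, g.map_one])

theorem boolMap_filter (g : WHom A C) (d : ℕ) {b : BoolPart A} (hb : b ∈ boolFilter A d) :
    boolMap g b ∈ boolFilter C d := by
  rw [mem_boolFilter, mem_primeInter_iff] at *
  exact fun g' hg' => hb (g.comp g') fun y => hg' _

end FunctorB

/-- The functor `A ↦ ⟨B(A), h_A⟩`, `g ↦ g|_{B(A)}`. -/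
def functorB (n : ℕ) [NeZero n] : WAlg.{u} n ⥤ BPair.{u} n where
  obj A :=
    { carrier := BoolPart A.carrier
      filt := fun d => boolFilter A.carrier d.1
      filt_self := boolFilter_self A.nvalued
      filt_gcd := fun d r => boolFilter_gcd A.nvalued d.2 r.2 }
  map g := ⟨boolMap g, fun d _ hb => boolMap_filter g d.1 hb⟩

/-! ### The algebra `M(B, h)`

The index set `{1, …, n}` is represented by `Fin n`: the index `i` is the element `i - 1` of
`Fin n`. Likewise `q ∈ {1, …, d}` is the element `q - 1` of `Fin d`. In the comments below the
indices start at `1`. The set `B^{[n]}` of increasing functions is `Fin n →o B`. -/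

section FunctorM

variable {n : ℕ} {B : Type u} [BooleanAlgebra B]

/-- `(¬f)(k) = ¬ f(n+1-k)` on `B^{[n]}`. -/
def seqNeg (f : Fin n →o B) : Fin n →o B where
  toFun k := (f k.rev)ᶜ
  monotone' _ _ h := compl_le_compl (f.monotone (Fin.rev_le_rev.2 h))

/-- `(f → g)(k) = ⋀_{i=1}^{n-k+1} (f(i) → g(i+k-1))` on `B^{[n]}`. -/
def seqImp (f g : Fin n →o B) : Fin n →o B where
  toFun k := Finset.univ.inf fun i : Fin (n - k) =>
    f ⟨i, by omega⟩ ⇨ g ⟨i + k, by omega⟩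
  monotone' k k' h := by
    refine Finset.le_inf fun i _ => ?_
    have h' : (k : ℕ) ≤ k' := h
    refine (Finset.inf_le (Finset.mem_univ (⟨i, by omega⟩ : Fin (n - k)))).trans ?_
    exact himp_le_himp_left (g.monotone (Fin.mk_le_mk.2 (by simp only; omega)))

theorem seqImp_apply (f g : Fin n →o B) (k : Fin n) :
    seqImp f g k = Finset.univ.inf fun i : Fin (n - k) =>
      f ⟨i, by omega⟩ ⇨ g ⟨i + k, by omega⟩ := rfl

/-- The constant function `1`. -/
def seqOne : Fin n →o B where
  toFun _ := ⊤
  monotone' _ _ _ := le_rfl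

theorem block_lt [NeZero n] (d : Divisor n) (q : Fin d.1) : (q + 1) * (n / d.1) - 1 < n := by
  have h1 : d.1 * (n / d.1) = n := Nat.mul_div_cancel' d.2
  have h2 := Nat.mul_le_mul_right (n / d.1) (Nat.succ_le_of_lt q.2)
  have := NeZero.pos n
  simp only [Nat.succ_eq_add_one] at h2
  omega

theorem block_lt' [NeZero n] (d : Divisor n) (q : Fin d.1) : q * (n / d.1) < n := by
  have h1 : d.1 * (n / d.1) = n := Nat.mul_div_cancel' d.2
  have h2 := Nat.mul_le_mul_right (n / d.1) (Nat.succ_le_of_lt q.2)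
  have := NeZero.pos n
  have h3 : 0 < n / d.1 := Nat.pos_of_ne_zero fun h => by rw [h] at h1; omega
  simp only [Nat.succ_eq_add_one, add_one_mul] at h2
  omega

/-- `ξ_{d,q}(f) = f(q n/d) → f((q-1) n/d + 1)` for `1 ≤ q ≤ d`. -/
def xi [NeZero n] (f : Fin n →o B) (d : Divisor n) (q : Fin d.1) : B :=
  f ⟨(q + 1) * (n / d.1) - 1, block_lt d q⟩ ⇨ f ⟨q * (n / d.1), block_lt' d q⟩

/-- `M(B,h) = {f ∈ B^{[n]} : ξ_{d,q}(f) ∈ h(d) for all d ∈ Div(n) and 1 ≤ q ≤ d}`. -/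
def MSet [NeZero n] (h : Divisor n → Order.PFilter B) : Type u :=
  {f : Fin n →o B // ∀ (d : Divisor n) (q : Fin d.1), xi f d q ∈ h d}

/-- The prime ideals of `B`. -/
def PrimeId (B : Type u) [BooleanAlgebra B] : Type u := {I : Order.Ideal B // I.IsPrime}

theorem le_of_primes {x y : B} (h : ∀ I : PrimeId B, x ∉ I.1 → y ∉ I.1) : x ≤ y := by
  by_contra hxy
  have hd : Disjoint (Order.PFilter.principal x : Set B) (Order.Ideal.principal y : Set B) := by
    rw [Set.disjoint_left]
    intro z hz hz'
    exact hxy (le_trans (Order.PFilter.mem_principal.1 hz) (Order.Ideal.mem_principal.1 hz'))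
  obtain ⟨J, hJ, hyJ, hxJ⟩ := DistribLattice.prime_ideal_of_disjoint_filter_ideal hd
  refine h ⟨J, hJ⟩ (fun hx => ?_) (hyJ (Order.Ideal.mem_principal.2 le_rfl))
  exact Set.disjoint_left.1 hxJ (Order.PFilter.mem_principal.2 le_rfl) hx

theorem prime_top (I : PrimeId B) : ⊤ ∉ I.1 :=
  fun h => I.2.toIsProper.top_notMem h

theorem prime_compl (I : PrimeId B) (x : B) : xᶜ ∉ I.1 ↔ x ∈ I.1 := by
  constructor
  · intro h
    exact (I.2.mem_or_compl_mem (x := x)).resolve_right h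
  · intro h h'
    have := Order.Ideal.sup_mem h h'
    rw [sup_compl_eq_top] at this
    exact prime_top I this

theorem prime_inf (I : PrimeId B) (x y : B) : x ⊓ y ∉ I.1 ↔ x ∉ I.1 ∧ y ∉ I.1 := by
  constructor
  · intro h
    exact ⟨fun hx => h (I.1.lower inf_le_left hx), fun hx => h (I.1.lower inf_le_right hx)⟩
  · rintro ⟨h, h'⟩ hxy
    exact (I.2.mem_or_mem hxy).elim h h'

theorem prime_himp (I : PrimeId B) (x y : B) : x ⇨ y ∉ I.1 ↔ (x ∉ I.1 → y ∉ I.1) := by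
  have h := prime_compl I x
  rw [himp_eq, Order.Ideal.sup_mem_iff]
  tauto

theorem prime_finset_inf {ι : Type} (I : PrimeId B) (s : Finset ι) (F : ι → B) :
    s.inf F ∉ I.1 ↔ ∀ i ∈ s, F i ∉ I.1 := by
  classical
  induction s using Finset.induction_on with
  | empty => simpa using prime_top I
  | insert a s ha ih => rw [Finset.inf_insert, prime_inf, ih]; simp

theorem exists_level (I : PrimeId B) (f : Fin n →o B) :
    ∃ a ≤ n, ∀ i : Fin n, f i ∉ I.1 ↔ n ≤ i + a := by
  classical
  by_cases h : ∃ i : ℕ, ∃ hi : i < n, f ⟨i, hi⟩ ∉ I.1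
  · obtain ⟨hlt, hf⟩ := Nat.find_spec h
    refine ⟨n - Nat.find h, Nat.sub_le _ _, fun i => ⟨fun hi => ?_, fun hi hi' => ?_⟩⟩
    · have := Nat.find_min' h ⟨i.2, hi⟩
      omega
    · exact hf (I.1.lower (f.monotone (Fin.mk_le_mk.2 (by omega) : (⟨_, hlt⟩ : Fin n) ≤ i)) hi')
  · refine ⟨0, Nat.zero_le _, fun i => ⟨fun hi => (h ⟨i, i.2, hi⟩).elim, fun hi => ?_⟩⟩
    omega

noncomputable def level (I : PrimeId B) (f : Fin n →o B) : ℕ := (exists_level I f).choose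

theorem level_le (I : PrimeId B) (f : Fin n →o B) : level I f ≤ n :=
  (exists_level I f).choose_spec.1

theorem level_spec (I : PrimeId B) (f : Fin n →o B) (i : Fin n) :
    f i ∉ I.1 ↔ n ≤ i + level I f :=
  (exists_level I f).choose_spec.2 i

theorem level_unique (I : PrimeId B) (f : Fin n →o B) {a : ℕ} (ha : a ≤ n)
    (h : ∀ i : Fin n, f i ∉ I.1 ↔ n ≤ i + a) : level I f = a := by
  have hl := level_le I f
  have key : ∀ i : Fin n, n ≤ i + level I f ↔ n ≤ i + a := fun i =>
    (level_spec I f i).symm.trans (h i)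
  by_contra hne
  rcases Nat.lt_or_gt_of_ne hne with h' | h'
  · have := (key ⟨n - a, by omega⟩).2 (by simp only; omega)
    simp only at this
    omega
  · have := (key ⟨n - level I f, by omega⟩).1 (by simp only; omega)
    simp only at this
    omega

theorem level_neg (I : PrimeId B) (f : Fin n →o B) : level I (seqNeg f) = n - level I f := by
  have hl := level_le I f
  refine level_unique I _ (Nat.sub_le _ _) fun i => ?_
  have h := level_spec I f i.rev
  rw [Fin.val_rev] at h
  show (f i.rev)ᶜ ∉ I.1 ↔ _
  rw [prime_compl, ← not_iff_not, h]
  omega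

theorem level_one (I : PrimeId B) : level I (seqOne : Fin n →o B) = n :=
  level_unique I _ le_rfl fun i => ⟨fun _ => by omega, fun _ => prime_top I⟩

theorem level_imp (I : PrimeId B) (f g : Fin n →o B) :
    level I (seqImp f g) = min n (n - level I f + level I g) := by
  have hf := level_le I f
  have hg := level_le I g
  refine level_unique I _ (min_le_left _ _) fun k => ?_
  rw [seqImp_apply, prime_finset_inf]
  constructor
  · intro h
    by_contra hk
    have := h ⟨n - level I f, by omega⟩ (Finset.mem_univ _)
    rw [prime_himp, level_spec, level_spec] at this
    simp only at this
    omega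
  · intro h i _
    rw [prime_himp, level_spec, level_spec]
    simp only
    omega

theorem seq_ext {f g : Fin n →o B} (h : ∀ I : PrimeId B, level I f = level I g) : f = g := by
  ext i
  refine le_antisymm (le_of_primes fun I hI => ?_) (le_of_primes fun I hI => ?_)
  · rwa [level_spec, ← h I, ← level_spec]
  · rwa [level_spec, h I, ← level_spec]

/-- The value in `L_{n+1}` of a sequence at a prime ideal. -/
noncomputable def seqVal (I : PrimeId B) (f : Fin n →o B) : unitInterval :=
  ⟨level I f / n, div_nonneg (Nat.cast_nonneg _) (Nat.cast_nonneg _),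
    div_le_one_of_le₀ (Nat.cast_le.2 (level_le I f)) (Nat.cast_nonneg _)⟩

theorem seqVal_chain (I : PrimeId B) (f : Fin n →o B) : seqVal I f ∈ chain n :=
  ⟨level I f, level_le I f, rfl⟩

/-- Composition with a homomorphism of Boolean algebras. -/
def seqMap {C : Type v} [BooleanAlgebra C] (θ : BoundedLatticeHom B C) (f : Fin n →o B) :
    Fin n →o C where
  toFun i := θ (f i)
  monotone' _ _ hij := OrderHomClass.mono θ (f.monotone hij)

theorem seqMap_imp {C : Type v} [BooleanAlgebra C] (θ : BoundedLatticeHom B C)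
    (f g : Fin n →o B) : seqMap θ (seqImp f g) = seqImp (seqMap θ f) (seqMap θ g) := by
  ext k
  rw [seqImp_apply]
  show θ (seqImp f g k) = _
  rw [seqImp_apply, map_finset_inf]
  refine Finset.inf_congr rfl fun i _ => ?_
  exact map_himp θ _ _

variable [NeZero n]

theorem seqVal_imp (I : PrimeId B) (f g : Fin n →o B) :
    seqVal I (seqImp f g) = seqVal I f ⇾ seqVal I g := by
  have hn : (n : ℝ) ≠ 0 := NeZero.ne (n : ℝ)
  apply Subtype.ext
  show (level I (seqImp f g) : ℝ) / n = min 1 (1 - (level I f : ℝ) / n + (level I g : ℝ) / n)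
  rw [level_imp, Nat.cast_min, Nat.cast_add, Nat.cast_sub (level_le I f),
    ← min_div_div_right (Nat.cast_nonneg n), div_self hn]
  congr 1
  field_simp

theorem seqVal_neg (I : PrimeId B) (f : Fin n →o B) : seqVal I (seqNeg f) = neg (seqVal I f) := by
  have hn : (n : ℝ) ≠ 0 := NeZero.ne (n : ℝ)
  apply Subtype.ext
  show (level I (seqNeg f) : ℝ) / n = 1 - (level I f : ℝ) / n
  rw [level_neg, Nat.cast_sub (level_le I f)]
  field_simp

theorem seqVal_one (I : PrimeId B) : seqVal I (seqOne : Fin n →o B) = one := by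
  have hn : (n : ℝ) ≠ 0 := NeZero.ne (n : ℝ)
  apply Subtype.ext
  show (level I (seqOne : Fin n →o B) : ℝ) / n = 1
  rw [level_one, div_self hn]

theorem seqVal_ext {f g : Fin n →o B} (h : ∀ I : PrimeId B, seqVal I f = seqVal I g) : f = g := by
  have hn : (n : ℝ) ≠ 0 := NeZero.ne (n : ℝ)
  refine seq_ext fun I => ?_
  have := congrArg Subtype.val (h I)
  exact_mod_cast (div_left_inj' hn).1 this

theorem dvd_level_iff (I : PrimeId B) (f : Fin n →o B) (d : Divisor n) :
    (∀ q, xi f d q ∉ I.1) ↔ n / d.1 ∣ level I f := by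
  have h1 : d.1 * (n / d.1) = n := Nat.mul_div_cancel' d.2
  have hn := NeZero.pos n
  have hl := level_le I f
  have hm : 0 < n / d.1 := Nat.pos_of_ne_zero fun h => by rw [h] at h1; omega
  simp only [xi, prime_himp, level_spec]
  generalize n / d.1 = m at *
  generalize level I f = a at *
  constructor
  · intro h
    by_contra hdvd
    have hmod : 0 < a % m := Nat.pos_of_ne_zero fun h0 => hdvd (Nat.dvd_of_mod_eq_zero h0)
    have hmod' : a % m < m := Nat.mod_lt _ hm
    have hdiv := Nat.div_add_mod a m
    have hs : a / m < d.1 := by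
      rw [Nat.div_lt_iff_lt_mul hm, h1]
      refine lt_of_le_of_ne hl ?_
      rintro rfl
      exact hdvd ⟨d.1, by rw [mul_comm, h1]⟩
    obtain ⟨s, hs'⟩ : ∃ s, d.1 = s + a / m + 1 := ⟨d.1 - 1 - a / m, by omega⟩
    rw [hs'] at h1
    have h2 : m * s + m * (a / m) + m = n := by rw [← h1]; ring
    have hlt : s < d.1 := hs' ▸ Nat.lt_succ_of_le (Nat.le_add_right _ _)
    have h3 := h ⟨s, hlt⟩
    have h4 : (s + 1) * m = m * s + m := by ring
    have h5 : s * m = m * s := mul_comm _ _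
    simp only [h4, h5] at h3
    omega
  · rintro ⟨s, rfl⟩ q hq
    have h4 : m * d.1 < m * (q + s + 1) := by
      have : ((q : ℕ) + 1) * m + m * s = m * (q + s + 1) := by ring
      have h5 : 0 < ((q : ℕ) + 1) * m := by positivity
      rw [← this, mul_comm m d.1, h1]
      omega
    have h6 : d.1 ≤ q + s := Nat.lt_succ_iff.1 (Nat.lt_of_mul_lt_mul_left h4)
    have h7 := Nat.mul_le_mul_left m h6
    rw [mul_comm m d.1, h1] at h7
    calc n ≤ m * (q + s) := h7
      _ = q * m + m * s := by ring

theorem finset_inf_mem {ι : Type} (F : Order.PFilter B) (s : Finset ι) (G : ι → B)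
    (h : ∀ i ∈ s, G i ∈ F) : s.inf G ∈ F := by
  classical
  induction s using Finset.induction_on with
  | empty => exact Order.PFilter.top_mem
  | insert a s ha ih =>
    rw [Finset.inf_insert]
    exact Order.PFilter.inf_mem (h a (by simp)) (ih fun i hi => h i (by simp [hi]))

variable {h : Divisor n → Order.PFilter B}

theorem xi_one_mem (d : Divisor n) (q : Fin d.1) : xi (seqOne : Fin n →o B) d q ∈ h d := by
  have : xi (seqOne : Fin n →o B) d q = ⊤ := himp_self
  rw [this]; exact Order.PFilter.top_mem

theorem xi_neg_mem {f : Fin n →o B} (hf : ∀ (d : Divisor n) (q : Fin d.1), xi f d q ∈ h d)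
    (d : Divisor n) (q : Fin d.1) : xi (seqNeg f) d q ∈ h d := by
  refine Order.PFilter.mem_of_le (le_of_primes fun I hI => ?_)
    (finset_inf_mem (h d) Finset.univ (xi f d) fun q _ => hf d q)
  rw [prime_finset_inf] at hI
  have h1 := (dvd_level_iff I f d).1 fun q => hI q (Finset.mem_univ _)
  refine (dvd_level_iff I _ d).2 ?_ q
  rw [level_neg]
  exact Nat.dvd_sub (Nat.div_dvd_of_dvd d.2) h1

theorem xi_imp_mem {f g : Fin n →o B} (hf : ∀ (d : Divisor n) (q : Fin d.1), xi f d q ∈ h d)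
    (hg : ∀ (d : Divisor n) (q : Fin d.1), xi g d q ∈ h d)
    (d : Divisor n) (q : Fin d.1) : xi (seqImp f g) d q ∈ h d := by
  refine Order.PFilter.mem_of_le (le_of_primes fun I hI => ?_) (Order.PFilter.inf_mem
    (finset_inf_mem (h d) Finset.univ (xi f d) fun q _ => hf d q)
    (finset_inf_mem (h d) Finset.univ (xi g d) fun q _ => hg d q))
  rw [prime_inf, prime_finset_inf, prime_finset_inf] at hI
  have h1 := (dvd_level_iff I f d).1 fun q => hI.1 q (Finset.mem_univ _)
  have h2 := (dvd_level_iff I g d).1 fun q => hI.2 q (Finset.mem_univ _)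
  have h3 : n / d.1 ∣ n := Nat.div_dvd_of_dvd d.2
  refine (dvd_level_iff I _ d).2 ?_ q
  rw [level_imp]
  rcases min_choice n (n - level I f + level I g) with e | e <;> rw [e]
  · exact h3
  · exact Nat.dvd_add (Nat.dvd_sub h3 h1) h2

theorem mset_ext {f g : MSet h} (H : ∀ I : PrimeId B, seqVal I f.1 = seqVal I g.1) : f = g :=
  Subtype.ext (seqVal_ext H)

instance : WajsbergAlgebra (MSet h) where
  imp f g := ⟨seqImp f.1 g.1, xi_imp_mem f.2 g.2⟩
  neg f := ⟨seqNeg f.1, xi_neg_mem f.2⟩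
  one := ⟨seqOne, xi_one_mem⟩
  one_imp x := mset_ext fun I => by simp only [seqVal_imp, seqVal_one, one_imp]
  imp_trans x y z := mset_ext fun I => by simp only [seqVal_imp, seqVal_one, imp_trans]
  imp_comm x y := mset_ext fun I => by
    simp only [seqVal_imp]; exact imp_comm _ _
  neg_imp_neg x y := mset_ext fun I => by
    simp only [seqVal_imp, seqVal_neg, seqVal_one, neg_imp_neg]

theorem mset_eval (I : PrimeId B) (v : ℕ → MSet h) :
    ∀ t : WTerm, seqVal I (t.eval v).1 = t.eval fun i => seqVal I (v i).1
  | .var i => rfl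
  | .imp s t => by
    rw [WTerm.eval, WTerm.eval, ← mset_eval I v s, ← mset_eval I v t]
    exact seqVal_imp I _ _
  | .neg s => by
    rw [WTerm.eval, WTerm.eval, ← mset_eval I v s]
    exact seqVal_neg I _
  | .one => seqVal_one I

theorem mset_nvalued : IsNValued n (MSet h) := fun s t hst v => mset_ext fun I => by
  rw [mset_eval, mset_eval]
  exact hst _ fun i => seqVal_chain I _

/-- The homomorphism `f ↦ θ ∘ f`. -/
def msetMap {C : Type v} [BooleanAlgebra C] {h' : Divisor n → Order.PFilter C}
    (θ : BoundedLatticeHom B C) (hθ : ∀ d, (h d : Set B) ⊆ θ ⁻¹' (h' d : Set C)) :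
    WHom (MSet h) (MSet h') where
  toFun f := ⟨seqMap θ f.1, fun d q => by
    have : xi (seqMap θ f.1) d q = θ (xi f.1 d q) := (map_himp θ _ _).symm
    rw [this]
    exact hθ d (f.2 d q)⟩
  map_imp f g := Subtype.ext (seqMap_imp θ f.1 g.1)
  map_neg f := Subtype.ext (OrderHom.ext _ _ (funext fun k => map_compl' θ _))
  map_one := Subtype.ext (OrderHom.ext _ _ (funext fun _ => map_top θ))

end FunctorM

/-- The functor `⟨B, h⟩ ↦ M(B, h)`, `θ ↦ θ ∘ -`. -/
def functorM (n : ℕ) [NeZero n] : BPair.{u} n ⥤ WAlg.{u} n where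
  obj X :=
    { carrier := MSet X.filt
      nvalued := mset_nvalued }
  map θ := msetMap θ.hom θ.map_filt

end Wajsberg

/-!
Everything is read off at points. A prime ideal `I` of `B` gives each increasing sequence `f` a
value `seqVal I f` in `L_{n+1}`, the number of terms of `f` outside `I` divided by `n`, and these
values separate sequences. On the other side, the homomorphisms of an `(n+1)`-valued algebra `A`
into `L_{n+1}` separate its elements. The two kinds of points agree: a homomorphism restricts to a
two-valued map on `B(A)`, which is a prime ideal (`exists_prime_of_hom`), and every prime ideal of
`B(A)` is the restriction of a homomorphism (`exists_hom_of_prime`).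

The unit `A → M(B(A), h_A)` sends `x` to the sequence of truth values of `x ≥ 1`, `x ≥ (n-1)/n`, …,
`x ≥ 1/n`, which are term functions of `x` (`boolSeq`). Its value at `I` is the value of `x` under
the homomorphism belonging to `I`, so that it is an injective homomorphism. For surjectivity let
`f` be a sequence in `M(B(A), h_A)`. At a single prime ideal `I`, the range of the homomorphism is
some `L_{d+1}` with `d ∣ n`, the filter `h_A(d)` avoids `I`, and the condition `ξ_{d,q}(f) ∈ h_A(d)`
says that the value of `f` at `I` lies in `L_{d+1}` (`exists_level_boolSeq_eq`). So `f` is matched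
by an element of `A` at `I`, hence on a clopen neighbourhood of `I`, and by compactness finitely
many such elements are glued to one that matches everywhere (`unitHom_surjective`).

The Boolean elements of `M(B, h)` are the constant sequences, which gives the counit `counitIso`. It
remains to see that it carries `h_{M(B,h)}(d)` to `h(d)` (`constHom_mem_boolFilter`). Every
homomorphism of `M(B, h)` into `L_{n+1}` is the evaluation at a prime ideal `I`; by the condition on
greatest common divisors, the divisors `d` with `h(d)` disjoint from `I` are the multiples of a least
one `r` (`exists_least_divisor`), and `M(B, h)` has a sequence of value `1/r` at `I`
(`exists_level_eq`). So the evaluation at `I` has its range in `L_{d+1}` if and only if `h(d)` is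
disjoint from `I`.
-/

namespace Wajsberg

open WajsbergAlgebra

/-! ### Homomorphisms into `[0,1]` and prime ideals of Boolean elements -/

section Points

theorem one_ne_neg_one_unit : (one : unitInterval) ≠ neg one := by
  rw [Ne, Subtype.ext_iff, unit_neg_val, unit_one_val]
  norm_num

/-- The Boolean elements of `[0,1]` are `0` and `1`. -/
theorem unit_bool_cases {x : unitInterval} (hx : odot x x = x) : x = one ∨ x = neg one := by
  have h := congrArg Subtype.val hx
  rw [odot, unit_neg_val, unit_imp_val, unit_neg_val] at h
  rcases min_choice (1 : ℝ) (1 - (x : ℝ) + (1 - x)) with e | e <;> rw [e] at h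
  · right
    rw [Subtype.ext_iff, unit_neg_val, unit_one_val]
    linarith
  · left
    rw [Subtype.ext_iff, unit_one_val]
    linarith

theorem hom_bool_cases {A : Type u} [WajsbergAlgebra A] (g : WHom A unitInterval)
    (b : BoolPart A) : g.toFun b.1 = one ∨ g.toFun b.1 = neg one :=
  unit_bool_cases (boolMap g b).2

/-- A homomorphism into `[0,1]` is two-valued on Boolean elements, so it cuts out a prime ideal
of every Boolean algebra mapping to them. -/
theorem exists_prime_of_hom {A : Type u} [WajsbergAlgebra A] {B : Type v} [BooleanAlgebra B]
    (θ : BoundedLatticeHom B (BoolPart A)) (g : WHom A unitInterval) :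
    ∃ I : PrimeId B, ∀ b, b ∉ I.1 ↔ g.toFun (θ b).1 = one := by
  have hsup : ∀ x y : B, g.toFun (θ (x ⊔ y)).1 =
      neg (g.toFun (θ x).1) ⇾ g.toFun (θ y).1 := fun x y => by
    rw [map_sup]
    show g.toFun (neg (θ x).1 ⇾ (θ y).1) = _
    rw [g.map_imp, g.map_neg]
  have hinf : ∀ x y : B, g.toFun (θ (x ⊓ y)).1 =
      odot (g.toFun (θ x).1) (g.toFun (θ y).1) := fun x y => by
    rw [map_inf]
    exact map_odot g _ _
  have hbot : g.toFun (θ ⊥).1 = neg one := by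
    rw [map_bot]
    exact congrArg Subtype.val (map_bot (boolMap g))
  have htop : g.toFun (θ ⊤).1 = one := by
    rw [map_top]
    exact congrArg Subtype.val (map_top (boolMap g))
  let J : Order.Ideal B :=
    { carrier := {b | g.toFun (θ b).1 = neg one}
      lower' := by
        intro a b hba (ha : _ = _)
        rcases hom_bool_cases g (θ b) with h | h
        · exfalso
          have h1 := hsup b a
          rw [sup_eq_right.2 hba, h, ha, w_bot] at h1
          exact one_ne_neg_one_unit h1.symm
        · exact h
      nonempty' := ⟨⊥, hbot⟩
      directed' := by
        intro a (ha : _ = _) b (hb : _ = _)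
        refine ⟨a ⊔ b, ?_, le_sup_left, le_sup_right⟩
        show _ = _
        rw [hsup, ha, hb, w_neg_neg, one_imp] }
  have hmem : ∀ b, b ∈ J ↔ g.toFun (θ b).1 = neg one := fun b => Iff.rfl
  have hJ : J.IsPrime := by
    have : J.IsProper := Order.Ideal.isProper_of_notMem (p := ⊤) fun h =>
      one_ne_neg_one_unit (htop.symm.trans h)
    refine Order.Ideal.IsPrime.of_mem_or_mem fun {x y} h => ?_
    rcases hom_bool_cases g (θ x) with hx | hx
    · rcases hom_bool_cases g (θ y) with hy | hy
      · have h1 := hinf x y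
        rw [(hmem _).1 h, hx, hy, bool_one] at h1
        exact (one_ne_neg_one_unit h1.symm).elim
      · exact .inr hy
    · exact .inl hx
  refine ⟨⟨J, hJ⟩, fun b => ?_⟩
  show ¬ (_ = _) ↔ _
  rcases hom_bool_cases g (θ b) with h | h <;> rw [h]
  · exact iff_of_true one_ne_neg_one_unit rfl
  · exact iff_of_false (fun h => h rfl) one_ne_neg_one_unit.symm

/-- Every prime ideal of `B(A)` comes from a homomorphism of `A` into `L_{n+1}`. -/
theorem exists_hom_of_prime {n : ℕ} [NeZero n] {A : Type u} [WajsbergAlgebra A]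
    (hA : IsNValued n A) (I : PrimeId (BoolPart A)) :
    ∃ g : WHom A unitInterval, (∀ x, g.toFun x ∈ chain n) ∧
      ∀ b : BoolPart A, b ∉ I.1 ↔ g.toFun b.1 = one := by
  -- the implicative filter generated by the Boolean elements outside `I`
  let G : Set A := {x | ∃ b : BoolPart A, b ∉ I.1 ∧ b.1 ⇾ x = one}
  have hG : IsImplicativeFilter G :=
    { one_mem := ⟨⊤, prime_top I, w_refl _⟩
      mp := by
        rintro x y ⟨b, hb, hbx⟩ ⟨c, hc, hcy⟩
        refine ⟨b ⊓ c, (prime_inf I b c).2 ⟨hb, hc⟩, ?_⟩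
        have h1 : (b ⊓ c).1 ⇾ x = one := w_trans (boolPart_le.1 inf_le_left) hbx
        have h2 : (b ⊓ c).1 ⇾ x ⇾ y = one := w_trans (boolPart_le.1 inf_le_right) hcy
        have h3 := w_trans h2 (w_anti y h1)
        rwa [bool_contract (b ⊓ c).2] at h3 }
  obtain ⟨g, hg, hgG, -⟩ := exists_hom hA hG (a := neg one) (by
    rintro ⟨b, hb, hb'⟩
    exact hb (I.1.lower (show b ≤ ⊥ from hb') I.1.bot_mem))
  have key : ∀ b : BoolPart A, b ∉ I.1 → g.toFun b.1 = one := fun b hb =>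
    hgG _ ⟨b, hb, w_refl _⟩
  refine ⟨g, hg, fun b => ⟨key b, fun h hb => ?_⟩⟩
  have h1 : g.toFun (neg b.1) = one := key bᶜ ((prime_compl I b).2 hb)
  rw [g.map_neg, h] at h1
  exact one_ne_neg_one_unit h1.symm

/-- Being equal at a prime ideal is witnessed by a Boolean element outside of it. -/
theorem exists_notMem_level_eq {n : ℕ} {B : Type u} [BooleanAlgebra B] {f g : Fin n →o B} {I : PrimeId B}
    (h : level I f = level I g) :
    ∃ b ∉ I.1, ∀ J : PrimeId B, b ∉ J.1 → level J f = level J g := by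
  refine ⟨Finset.univ.inf fun i => (f i ⇨ g i) ⊓ (g i ⇨ f i), ?_, fun J hJ => ?_⟩
  · rw [prime_finset_inf]
    intro i _
    rw [prime_inf, prime_himp, prime_himp, level_spec, level_spec, h]
    exact ⟨id, id⟩
  · refine level_unique J _ (level_le J g) fun i => ?_
    rw [prime_finset_inf] at hJ
    have := hJ i (Finset.mem_univ _)
    rw [prime_inf, prime_himp, prime_himp] at this
    rw [← level_spec J g]
    exact ⟨this.1, this.2⟩

end Points

/-! ### The sequence of Boolean elements of an element -/

section Unit

variable {n : ℕ} [NeZero n] {A : Type u} [WajsbergAlgebra A]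

theorem trunc_chain {m l : ℕ} {x : unitInterval} (hx : (x : ℝ) = l / n) :
    trunc x n m = if m ≤ l then one else neg one := by
  have hn : (n : ℝ) ≠ 0 := NeZero.ne (n : ℝ)
  have e : (n : ℝ) * x = l := by rw [hx]; field_simp
  apply Subtype.ext
  rw [trunc_val, e]
  split_ifs with h
  · have h' : (m : ℝ) ≤ l := by exact_mod_cast h
    rw [unit_one_val, min_eq_left (by linarith), max_eq_right zero_le_one]
  · have h' : (l : ℝ) + 1 ≤ m := by exact_mod_cast not_le.1 h
    rw [unit_neg_val, unit_one_val, sub_self, max_eq_left]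
    exact (min_le_right _ _).trans (by linarith)

theorem bool_trunc (hA : IsNValued n A) (m : ℕ) (x : A) :
    odot (trunc x n m) (trunc x n m) = trunc x n m := by
  refine hom_ext hA fun g hg => ?_
  obtain ⟨l, -, hl⟩ := hg x
  rw [map_odot, map_trunc, trunc_chain hl]
  split_ifs
  · exact bool_one
  · exact bool_neg bool_one

theorem trunc_anti (hA : IsNValued n A) {m m' : ℕ} (h : m' ≤ m) (x : A) :
    trunc x n m ⇾ trunc x n m' = one := by
  refine hom_ext hA fun g hg => ?_
  obtain ⟨l, -, hl⟩ := hg x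
  rw [g.map_imp, map_trunc, map_trunc, trunc_chain hl, trunc_chain hl, g.map_one]
  by_cases h1 : m ≤ l
  · rw [if_pos (h.trans h1), w_top]
  · rw [if_neg h1, w_bot]

/-- The increasing sequence of Boolean elements whose `i`-th term (indices from `0`) is the
truth value of `x ≥ (n - i) / n`. -/
def boolSeq (hA : IsNValued n A) (x : A) : Fin n →o BoolPart A where
  toFun i := ⟨trunc x n (n - i), bool_trunc hA _ x⟩
  monotone' _ _ hij := trunc_anti hA (Nat.sub_le_sub_left hij n) x

/-- If the prime ideal `I` comes from the homomorphism `g`, then the value of the sequence of `x`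
at `I` is `g x`. -/
theorem level_boolSeq (hA : IsNValued n A) {I : PrimeId (BoolPart A)} {g : WHom A unitInterval}
    (hI : ∀ b : BoolPart A, b ∉ I.1 ↔ g.toFun b.1 = one) {x : A} {l : ℕ} (hln : l ≤ n)
    (hl : (g.toFun x : ℝ) = l / n) : level I (boolSeq hA x) = l := by
  refine level_unique I _ hln fun i => ?_
  rw [hI]
  show g.toFun (trunc x n (n - i)) = one ↔ _
  rw [map_trunc, trunc_chain hl]
  split_ifs with h
  · exact iff_of_true rfl (by omega)
  · exact iff_of_false one_ne_neg_one_unit.symm (by omega)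

theorem seqVal_boolSeq (hA : IsNValued n A) {I : PrimeId (BoolPart A)} {g : WHom A unitInterval}
    (hg : ∀ x, g.toFun x ∈ chain n)
    (hI : ∀ b : BoolPart A, b ∉ I.1 ↔ g.toFun b.1 = one) (x : A) :
    seqVal I (boolSeq hA x) = g.toFun x := by
  obtain ⟨l, hln, hl⟩ := hg x
  apply Subtype.ext
  show (level I (boolSeq hA x) : ℝ) / n = _
  rw [hl, level_boolSeq hA hI hln hl]

theorem xi_boolSeq_mem (hA : IsNValued n A) (x : A) (d : Divisor n) (q : Fin d.1) :
    xi (boolSeq hA x) d q ∈ boolFilter A d.1 := by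
  rw [mem_boolFilter, mem_primeInter_iff]
  intro g hg
  obtain ⟨I, hI⟩ := exists_prime_of_hom (BoundedLatticeHom.id (BoolPart A)) g
  refine (hI _).1 ((dvd_level_iff I _ d).2 ?_ q)
  obtain ⟨k, hk, e⟩ := hg x
  have hn : (n : ℝ) ≠ 0 := NeZero.ne (n : ℝ)
  have hdn : d.1 * (n / d.1) = n := Nat.mul_div_cancel' d.2
  have hle : k * (n / d.1) ≤ n := by
    calc k * (n / d.1) ≤ d.1 * (n / d.1) := Nat.mul_le_mul_right _ hk
      _ = n := hdn
  rw [level_boolSeq hA hI hle]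
  · exact dvd_mul_left _ _
  · have hd : (d.1 : ℝ) * ((n / d.1 : ℕ) : ℝ) = n := by exact_mod_cast hdn
    have hd0 : (d.1 : ℝ) ≠ 0 := fun h => hn (by rw [← hd, h, zero_mul])
    have hd1 : ((n / d.1 : ℕ) : ℝ) ≠ 0 := fun h => hn (by rw [← hd, h, mul_zero])
    rw [e, Nat.cast_mul, ← hd, mul_div_mul_right _ _ hd1]

/-- The homomorphism `A → M(B(A), h_A)`. -/
def unitHom (hA : IsNValued n A) :
    WHom A (MSet (n := n) fun d : Divisor n => boolFilter A d.1) where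
  toFun x := ⟨boolSeq hA x, xi_boolSeq_mem hA x⟩
  map_imp x y := mset_ext fun I => by
    obtain ⟨g, hg, hI⟩ := exists_hom_of_prime hA I
    show seqVal I (boolSeq hA (x ⇾ y)) = seqVal I (seqImp (boolSeq hA x) (boolSeq hA y))
    rw [seqVal_imp, seqVal_boolSeq hA hg hI, seqVal_boolSeq hA hg hI, seqVal_boolSeq hA hg hI,
      g.map_imp]
  map_neg x := mset_ext fun I => by
    obtain ⟨g, hg, hI⟩ := exists_hom_of_prime hA I
    show seqVal I (boolSeq hA (neg x)) = seqVal I (seqNeg (boolSeq hA x))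
    rw [seqVal_neg, seqVal_boolSeq hA hg hI, seqVal_boolSeq hA hg hI, g.map_neg]
  map_one := mset_ext fun I => by
    obtain ⟨g, hg, hI⟩ := exists_hom_of_prime hA I
    show seqVal I (boolSeq hA one) = seqVal I seqOne
    rw [seqVal_one, seqVal_boolSeq hA hg hI, g.map_one]

theorem unitHom_injective (hA : IsNValued n A) : Function.Injective (unitHom hA).toFun := by
  intro x y hxy
  refine hom_ext hA fun g hg => ?_
  obtain ⟨I, hI⟩ := exists_prime_of_hom (BoundedLatticeHom.id (BoolPart A)) g
  have hxy' : boolSeq hA x = boolSeq hA y := congrArg Subtype.val hxy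
  rw [← seqVal_boolSeq hA hg hI x, hxy', seqVal_boolSeq hA hg hI y]

/-- A set of natural numbers that is closed under truncated subtraction and contains `n > 0`
consists, up to `n`, of the multiples of a divisor of `n`. -/
theorem exists_dvd_of_sub_closed {n : ℕ} (hn : 0 < n) {S : Set ℕ} (hS : n ∈ S)
    (hsub : ∀ a ∈ S, ∀ b ∈ S, a - b ∈ S) :
    ∃ m, m ∣ n ∧ (∀ a ∈ S, m ∣ a) ∧ ∀ j ≤ n, m ∣ j → j ∈ S := by
  classical
  have hex : ∃ m, 0 < m ∧ m ∈ S := ⟨n, hn, hS⟩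
  obtain ⟨m, ⟨hm0, hmS⟩, hmin⟩ : ∃ m, (0 < m ∧ m ∈ S) ∧ ∀ k, 0 < k ∧ k ∈ S → m ≤ k :=
    ⟨Nat.find hex, Nat.find_spec hex, fun _ hk => Nat.find_min' hex hk⟩
  have hsubmul : ∀ a ∈ S, ∀ k, a - k * m ∈ S := by
    intro a ha k
    induction k with
    | zero => simpa using ha
    | succ k ih =>
      rw [add_one_mul, ← Nat.sub_sub]
      exact hsub _ ih _ hmS
  have hdvd : ∀ a ∈ S, m ∣ a := by
    intro a ha
    have h1 := hsubmul a ha (a / m)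
    have h2 : a - a / m * m = a % m := by
      have := Nat.div_add_mod' a m
      omega
    rw [h2] at h1
    by_contra hnd
    have h3 := hmin _ ⟨Nat.pos_of_ne_zero fun h0 => hnd (Nat.dvd_of_mod_eq_zero h0), h1⟩
    exact absurd (Nat.mod_lt a hm0) (not_lt.2 h3)
  refine ⟨m, hdvd n hS, hdvd, fun j hj hmj => ?_⟩
  obtain ⟨k, hk⟩ := Nat.dvd_sub (hdvd n hS) hmj
  have h1 := hsubmul n hS k
  rwa [mul_comm, ← hk, Nat.sub_sub_self hj] at h1

/-- The range of a homomorphism into `L_{n+1}` is some `L_{d+1}` with `d ∣ n`; hence it contains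
the value of every sequence of `M(B(A), h_A)` at the corresponding prime ideal. -/
theorem exists_level_boolSeq_eq (hA : IsNValued n A)
    (f : MSet (n := n) fun d : Divisor n => boolFilter A d.1) (I : PrimeId (BoolPart A)) :
    ∃ x : A, level I (boolSeq hA x) = level I f.1 := by
  obtain ⟨g, hg, hI⟩ := exists_hom_of_prime hA I
  have hn := NeZero.pos n
  have hn' : (n : ℝ) ≠ 0 := NeZero.ne (n : ℝ)
  let S : Set ℕ := {a | ∃ x : A, level I (boolSeq hA x) = a}
  have hval : ∀ x, seqVal I (boolSeq hA x) = g.toFun x := seqVal_boolSeq hA hg hI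
  have hlev : ∀ x y : A, level I (boolSeq hA (neg (x ⇾ y))) =
      level I (boolSeq hA x) - level I (boolSeq hA y) := by
    intro x y
    have h1 : (unitHom hA).toFun (neg (x ⇾ y)) =
        neg ((unitHom hA).toFun x ⇾ (unitHom hA).toFun y) := by
      rw [WHom.map_neg, WHom.map_imp]
    have h2 : boolSeq hA (neg (x ⇾ y)) = seqNeg (seqImp (boolSeq hA x) (boolSeq hA y)) :=
      congrArg Subtype.val h1
    rw [h2, level_neg, level_imp]
    have := level_le I (boolSeq hA x)
    omega
  have hone : level I (boolSeq hA one) = n := by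
    refine level_boolSeq hA hI le_rfl ?_
    rw [g.map_one, unit_one_val, div_self hn']
  obtain ⟨m, hmn, hdvd, hmem⟩ := exists_dvd_of_sub_closed hn (S := S) ⟨one, hone⟩ (by
    rintro _ ⟨x, rfl⟩ _ ⟨y, rfl⟩
    exact ⟨_, hlev x y⟩)
  refine hmem _ (level_le I _) ?_
  have hm0 : 0 < m := Nat.pos_of_dvd_of_pos hmn hn
  let d : Divisor n := ⟨n / m, Nat.div_dvd_of_dvd hmn⟩
  have hd : n / d.1 = m := Nat.div_div_self hmn hn.ne'
  have hgd : ∀ x, g.toFun x ∈ chain d.1 := by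
    intro x
    obtain ⟨k, hk⟩ := hdvd _ ⟨x, rfl⟩
    have hle := level_le I (boolSeq hA x)
    have hdm : d.1 * m = n := Nat.div_mul_cancel hmn
    rw [hk, ← hdm, mul_comm d.1] at hle
    refine ⟨k, Nat.le_of_mul_le_mul_left hle hm0, ?_⟩
    rw [← hval x]
    show (level I (boolSeq hA x) : ℝ) / n = _
    have hm' : (m : ℝ) ≠ 0 := by exact_mod_cast hm0.ne'
    rw [hk]
    conv_lhs => rw [← hdm]
    rw [Nat.cast_mul, Nat.cast_mul, mul_comm (d.1 : ℝ), mul_div_mul_left _ _ hm']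
  rw [← hd]
  refine (dvd_level_iff I f.1 d).1 fun q => (hI _).2 ?_
  have hq := f.2 d q
  rw [mem_boolFilter, mem_primeInter_iff] at hq
  exact hq g hgd

/-- `(b → x) ⊙ (¬b → y)` is `x` where `b` holds and `y` elsewhere. -/
theorem map_glue (g : WHom A unitInterval) (b : BoolPart A) (x y : A) :
    g.toFun (odot (b.1 ⇾ x) (neg b.1 ⇾ y)) =
      if g.toFun b.1 = one then g.toFun x else g.toFun y := by
  rw [map_odot, g.map_imp, g.map_imp, g.map_neg]
  split_ifs with h
  · rw [h, one_imp, w_bot, odot_comm, odot, one_imp, w_neg_neg]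
  · rw [(hom_bool_cases g b).resolve_left h, w_bot, w_neg_neg, one_imp, odot, one_imp, w_neg_neg]

/-- A sequence of `M(B(A), h_A)` is matched by an element of `A` at every prime ideal, hence on a
clopen neighbourhood of it. The Boolean elements on which a single element of `A` matches form an
ideal, as two elements of `A` can be glued along a Boolean one; lying in no prime ideal, it
contains `⊤`. -/
theorem unitHom_surjective (hA : IsNValued n A) : Function.Surjective (unitHom hA).toFun := by
  intro f
  let J : Order.Ideal (BoolPart A) :=
    { carrier := {b | ∃ x : A, ∀ I : PrimeId (BoolPart A), b ∉ I.1 →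
        seqVal I (boolSeq hA x) = seqVal I f.1}
      lower' := by
        rintro a b hba ⟨x, hx⟩
        exact ⟨x, fun I hb => hx I fun ha => hb (I.1.lower hba ha)⟩
      nonempty' := ⟨⊥, one, fun I hI => (hI I.1.bot_mem).elim⟩
      directed' := by
        rintro b ⟨x, hx⟩ c ⟨y, hy⟩
        refine ⟨b ⊔ c, ⟨odot (b.1 ⇾ x) (neg b.1 ⇾ y), fun I hbc => ?_⟩, le_sup_left, le_sup_right⟩
        obtain ⟨g, hg, hI⟩ := exists_hom_of_prime hA I
        rw [seqVal_boolSeq hA hg hI, map_glue]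
        split_ifs with h
        · rw [← hx I ((hI b).2 h), seqVal_boolSeq hA hg hI]
        · have hb : b ∈ I.1 := not_not.1 (mt (hI b).1 h)
          rw [← hy I fun hc => hbc (Order.Ideal.sup_mem hb hc), seqVal_boolSeq hA hg hI] }
  have htop : (⊤ : BoolPart A) ∈ J := by
    by_contra hJ
    have hd : Disjoint (Order.PFilter.principal (⊤ : BoolPart A) : Set (BoolPart A))
        (J : Set (BoolPart A)) := by
      rw [Set.disjoint_left]
      intro z hz hz'
      rw [SetLike.mem_coe, Order.PFilter.mem_principal, top_le_iff] at hz
      exact hJ (hz ▸ hz')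
    obtain ⟨I, hI, hJI, -⟩ := DistribLattice.prime_ideal_of_disjoint_filter_ideal hd
    obtain ⟨x, hx⟩ := exists_level_boolSeq_eq hA f ⟨I, hI⟩
    obtain ⟨b, hb, hbx⟩ := exists_notMem_level_eq hx
    exact hb (hJI ⟨x, fun I' hI' => by simp only [seqVal, hbx I' hI']⟩)
  obtain ⟨x, hx⟩ := htop
  exact ⟨x, mset_ext fun I => hx I (prime_top I)⟩

end Unit

/-! ### The Boolean elements of `M(B, h)` -/

section Counit

variable {n : ℕ} {B : Type u} [BooleanAlgebra B]

/-- The constant sequences. -/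
def seqConst (b : B) : Fin n →o B where
  toFun _ := b
  monotone' _ _ _ := le_rfl

theorem seqImp_eq_one_iff {f g : Fin n →o B} : seqImp f g = seqOne ↔ ∀ i, f i ≤ g i := by
  constructor
  · intro hfg i
    refine le_of_primes fun I hI => ?_
    have h1 := congrArg (level I) hfg
    have := level_le I f
    rw [level_imp, level_one] at h1
    rw [level_spec] at hI ⊢
    omega
  · intro hfg
    ext k
    rw [seqImp_apply]
    refine top_unique (Finset.le_inf fun i _ => ?_)
    rw [top_le_iff, himp_eq_top_iff]
    exact (hfg _).trans (g.monotone (Fin.mk_le_mk.2 (Nat.le_add_right _ _)))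

theorem level_of_odot_self {f : Fin n →o B} (hf : seqNeg (seqImp f (seqNeg f)) = f)
    (I : PrimeId B) : level I f = 0 ∨ level I f = n := by
  have h1 := congrArg (level I) hf
  have := level_le I f
  rw [level_neg, level_imp, level_neg] at h1
  omega

/-- The Boolean sequences are the constant ones. -/
theorem eq_of_odot_self {f : Fin n →o B} (hf : seqNeg (seqImp f (seqNeg f)) = f) (i j : Fin n) :
    f i ≤ f j := by
  refine le_of_primes fun I hI => ?_
  rw [level_spec] at hI ⊢
  rcases level_of_odot_self hf I with h1 | h1 <;> omega

theorem seqConst_odot_self (b : B) :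
    seqNeg (seqImp (seqConst b) (seqNeg (seqConst b))) = (seqConst b : Fin n →o B) := by
  refine seq_ext fun I => ?_
  have h1 : level I (seqConst b : Fin n →o B) = 0 ∨ level I (seqConst b : Fin n →o B) = n := by
    by_cases hb : b ∈ I.1
    · exact .inl (level_unique I _ (Nat.zero_le _) fun i =>
        iff_of_false (fun h => h hb) (by omega))
    · exact .inr (level_unique I _ le_rfl fun i => iff_of_true hb (by omega))
  rw [level_neg, level_imp, level_neg]
  omega

variable [NeZero n] {h : Divisor n → Order.PFilter B}

/-- The Boolean algebra of Boolean elements of `M(B, h)` is `B`: a Boolean element is a constant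
sequence, and corresponds to its value. -/
def counitIso (h : Divisor n → Order.PFilter B) : BoolPart (MSet h) ≃o B where
  toFun F := F.1.1 ⟨0, NeZero.pos n⟩
  invFun b := ⟨⟨seqConst b, fun d q => by
    have : xi (seqConst b : Fin n →o B) d q = ⊤ := himp_self
    rw [this]; exact Order.PFilter.top_mem⟩, Subtype.ext (seqConst_odot_self b)⟩
  left_inv F := by
    have hF : seqNeg (seqImp F.1.1 (seqNeg F.1.1)) = F.1.1 := congrArg Subtype.val F.2
    refine Subtype.ext (Subtype.ext (OrderHom.ext _ _ (funext fun i => ?_)))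
    exact le_antisymm (eq_of_odot_self hF _ _) (eq_of_odot_self hF _ _)
  right_inv b := rfl
  map_rel_iff' {F G} := by
    have hF : seqNeg (seqImp F.1.1 (seqNeg F.1.1)) = F.1.1 := congrArg Subtype.val F.2
    have e : F ≤ G ↔ seqImp F.1.1 G.1.1 = seqOne :=
      ⟨fun h => congrArg Subtype.val h, fun h => Subtype.ext h⟩
    rw [e, seqImp_eq_one_iff]
    exact ⟨fun h i => (eq_of_odot_self hF _ _).trans (h.trans (G.1.1.monotone (Nat.zero_le _))),
      fun h => h _⟩

/-- A Boolean element of `M(B, h)` goes to its constant value. -/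
def valueHom (h : Divisor n → Order.PFilter B) : BoundedLatticeHom (BoolPart (MSet h)) B where
  toFun := counitIso h
  map_sup' := map_sup (counitIso h)
  map_inf' := map_inf (counitIso h)
  map_top' := map_top (counitIso h)
  map_bot' := map_bot (counitIso h)

/-- The embedding of `B` in `M(B, h)` by constant sequences. -/
def constHom (h : Divisor n → Order.PFilter B) : BoundedLatticeHom B (BoolPart (MSet h)) where
  toFun := (counitIso h).symm
  map_sup' := map_sup (counitIso h).symm
  map_inf' := map_inf (counitIso h).symm
  map_top' := map_top (counitIso h).symm
  map_bot' := map_bot (counitIso h).symm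

/-- Evaluation at a prime ideal, as a homomorphism. -/
noncomputable def evalHom (h : Divisor n → Order.PFilter B) (I : PrimeId B) :
    WHom (MSet h) unitInterval where
  toFun f := seqVal I f.1
  map_imp f g := seqVal_imp I f.1 g.1
  map_neg f := seqVal_neg I f.1
  map_one := seqVal_one I

theorem evalHom_const (I : PrimeId B) (b : B) :
    (evalHom h I).toFun (constHom h b).1 = one ↔ b ∉ I.1 := by
  have hn : (n : ℝ) ≠ 0 := NeZero.ne (n : ℝ)
  rw [Subtype.ext_iff, unit_one_val]
  show (level I (seqConst b : Fin n →o B) : ℝ) / n = 1 ↔ _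
  rw [div_eq_one_iff_eq hn, Nat.cast_inj]
  constructor
  · intro e
    exact (level_spec I (seqConst b : Fin n →o B) ⟨0, NeZero.pos n⟩).2 (by omega)
  · intro hb
    exact level_unique I _ le_rfl fun i => iff_of_true hb (by omega)

/-- The terms of a sequence `f`, as constant sequences, are term functions of `f`. -/
theorem trunc_eq_constHom (f : MSet h) (i : Fin n) :
    trunc f n (n - i) = (constHom h (f.1 i)).1 := by
  refine mset_ext fun I => ?_
  show (evalHom h I).toFun _ = (evalHom h I).toFun _
  rw [map_trunc, trunc_chain (l := level I f.1) rfl]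
  have h1 := evalHom_const (h := h) I (f.1 i)
  rw [level_spec] at h1
  split_ifs with hi
  · exact (h1.2 (by omega)).symm
  · exact ((hom_bool_cases (evalHom h I) _).resolve_left fun e => hi (by
      have := h1.1 e
      omega)).symm

/-- Every homomorphism of `M(B, h)` into `L_{n+1}` is the evaluation at a prime ideal. -/
theorem exists_prime_eq_seqVal (g : WHom (MSet h) unitInterval) (hg : ∀ f, g.toFun f ∈ chain n) :
    ∃ I : PrimeId B, (∀ b, b ∉ I.1 ↔ g.toFun (constHom h b).1 = one) ∧
      ∀ f, g.toFun f = seqVal I f.1 := by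
  obtain ⟨I, hI⟩ := exists_prime_of_hom (constHom h) g
  refine ⟨I, hI, fun f => ?_⟩
  obtain ⟨l, hln, hl⟩ := hg f
  apply Subtype.ext
  show _ = (level I f.1 : ℝ) / n
  rw [hl, level_unique I f.1 hln fun i => ?_]
  rw [hI, ← trunc_eq_constHom, map_trunc, trunc_chain hl]
  split_ifs with hi
  · exact iff_of_true rfl (by omega)
  · exact iff_of_false one_ne_neg_one_unit.symm (by omega)

/-- For a prime ideal `I`, the divisors `d` with `h(d)` disjoint from `I` are the multiples of one
of them, by the condition on greatest common divisors. -/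
theorem exists_least_divisor (hself : (h ⟨n, dvd_rfl⟩ : Set B) = {⊤})
    (hgcd : ∀ d r : Divisor n, IsLUB {h d, h r} (h (d.gcd r))) (I : PrimeId B) :
    ∃ r : Divisor n, ∀ d : Divisor n, (∀ b ∈ h d, b ∉ I.1) ↔ r.1 ∣ d.1 := by
  classical
  have hinter : ∀ d r : Divisor n, (∀ b ∈ h d, b ∉ I.1) → (∀ b ∈ h r, b ∉ I.1) →
      ∀ b ∈ h (d.gcd r), b ∉ I.1 := by
    intro d r hd hr
    -- the filter of the elements outside `I`
    have hI : Order.IsPFilter {b : B | b ∉ I.1} := Order.IsPFilter.of_def ⟨⊤, prime_top I⟩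
      (fun x hx y hy => ⟨x ⊓ y, (prime_inf I x y).2 ⟨hx, hy⟩, inf_le_left, inf_le_right⟩)
      (fun hxy hx hy => hx (I.1.lower hxy hy))
    have hle : h (d.gcd r) ≤ hI.toPFilter := (hgcd d r).2 (by
      rintro _ (rfl | rfl)
      exacts [hd, hr])
    exact fun b hb => hle hb
  have hex : ∃ r : ℕ, ∃ hr : r ∣ n, ∀ b ∈ h ⟨r, hr⟩, b ∉ I.1 := ⟨n, dvd_rfl, fun b hb => by
    have hb' : b ∈ (h ⟨n, dvd_rfl⟩ : Set B) := hb
    rw [hself, Set.mem_singleton_iff] at hb'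
    rw [hb']
    exact prime_top I⟩
  obtain ⟨hrn, hr⟩ := Nat.find_spec hex
  have hmin := fun k hk => Nat.find_min' hex (m := k) hk
  refine ⟨⟨Nat.find hex, hrn⟩, fun d => ⟨fun hd => ?_, fun hrd => ?_⟩⟩
  · have h1 := hmin _ ⟨(Divisor.gcd d ⟨_, hrn⟩).2, hinter d ⟨_, hrn⟩ hd hr⟩
    have hpos := Nat.pos_of_dvd_of_pos hrn (NeZero.pos n)
    have h2 : Nat.gcd d.1 (Nat.find hex) = Nat.find hex :=
      le_antisymm (Nat.gcd_le_right _ hpos) h1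
    have h3 := Nat.gcd_dvd_left d.1 (Nat.find hex)
    rwa [h2] at h3
  · intro b hb
    have e : Divisor.gcd d ⟨_, hrn⟩ = ⟨_, hrn⟩ := Subtype.ext (Nat.gcd_eq_right hrd)
    have hle : h d ≤ h (Divisor.gcd d ⟨_, hrn⟩) := (hgcd d ⟨_, hrn⟩).1 (Set.mem_insert _ _)
    rw [e] at hle
    exact hr b (hle hb)

/-- Every prime ideal `I` has a sequence in `M(B, h)` whose value at `I` is `1/r`, where `r` is the
least divisor with `h(r)` disjoint from `I`. -/
theorem exists_level_eq (I : PrimeId B) (r : Divisor n)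
    (hr : ∀ d : Divisor n, (∀ b ∈ h d, b ∉ I.1) → r.1 ∣ d.1) :
    ∃ f : MSet h, level I f.1 = n / r.1 := by
  classical
  have : Finite (Divisor n) := (Set.finite_Iic n).subset
    (fun d (hd : d ∣ n) => Nat.le_of_dvd (NeZero.pos n) hd)
  have := Fintype.ofFinite (Divisor n)
  have hb : ∀ d : Divisor n, ∃ b, b ∈ I.1 ∧ (b ∈ h d ∨ r.1 ∣ d.1) := by
    intro d
    by_cases hd : r.1 ∣ d.1
    · exact ⟨⊥, I.1.bot_mem, .inr hd⟩
    · have := mt (hr d) hd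
      push Not at this
      obtain ⟨b, hb, hbI⟩ := this
      exact ⟨b, hbI, .inl hb⟩
  choose b hbI hbh using hb
  -- the sequence has level `n / r` where `c` holds and level `0` elsewhere
  let c : B := Finset.univ.inf fun d => (b d)ᶜ
  have hc : c ∉ I.1 := (prime_finset_inf I _ _).2 fun d _ => (prime_compl I _).2 (hbI d)
  have hle : n / r.1 ≤ n := Nat.div_le_self _ _
  let f : Fin n →o B :=
    { toFun := fun i => if n ≤ i + n / r.1 then c else ⊥
      monotone' := fun i j hij => by
        have hij' : (i : ℕ) ≤ j := hij
        dsimp only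
        split_ifs with h1 h2
        · exact le_rfl
        · omega
        · exact bot_le
        · exact le_rfl }
  have hf : ∀ J : PrimeId B, (c ∉ J.1 → level J f = n / r.1) ∧ (c ∈ J.1 → level J f = 0) := by
    intro J
    constructor
    · intro hcJ
      refine level_unique J f hle fun i => ?_
      show (if n ≤ i + n / r.1 then c else ⊥) ∉ J.1 ↔ _
      split_ifs with hi
      · exact iff_of_true hcJ hi
      · exact iff_of_false (fun h => h J.1.bot_mem) hi
    · intro hcJ
      refine level_unique J f (Nat.zero_le _) fun i => iff_of_false ?_ (by omega)
      show ¬ (if n ≤ i + n / r.1 then c else ⊥) ∉ J.1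
      split_ifs with hi
      · exact fun h => h hcJ
      · exact fun h => h J.1.bot_mem
  refine ⟨⟨f, fun d q => ?_⟩, (hf I).1 hc⟩
  rcases hbh d with hd | hd
  · refine Order.PFilter.mem_of_le (le_of_primes fun J hJ => ?_) hd
    have hcJ : c ∈ J.1 := J.1.lower (Finset.inf_le (Finset.mem_univ d))
      (not_not.1 (mt (prime_compl J _).1 hJ))
    exact (dvd_level_iff J f d).2 (by rw [(hf J).2 hcJ]; exact dvd_zero _) q
  · refine Order.PFilter.mem_of_le (le_of_primes fun J _ => ?_) (Order.PFilter.top_mem (F := h d))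
    refine (dvd_level_iff J f d).2 ?_ q
    by_cases hcJ : c ∈ J.1
    · rw [(hf J).2 hcJ]; exact dvd_zero _
    · rw [(hf J).1 hcJ]
      exact Nat.div_dvd_div_left d.2 hd

/-- The counit identifies `h_{M(B,h)}(d)` with `h(d)`. If `b ∉ h(d)`, a prime ideal containing `b`
and disjoint from `h(d)` gives an evaluation into `L_{d+1}` that is `0` at `b`. Conversely, if the
evaluation at `I` has its range in `L_{d+1}`, then so lies its value `1/r`, whence `r ∣ d` and `I`
avoids `h(d)`. -/
theorem constHom_mem_boolFilter (hself : (h ⟨n, dvd_rfl⟩ : Set B) = {⊤})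
    (hgcd : ∀ d r : Divisor n, IsLUB {h d, h r} (h (d.gcd r))) {d : Divisor n} {b : B} :
    constHom h b ∈ boolFilter (MSet h) d.1 ↔ b ∈ h d := by
  have hn : (n : ℝ) ≠ 0 := NeZero.ne (n : ℝ)
  have hn0 := NeZero.pos n
  rw [mem_boolFilter, mem_primeInter_iff]
  constructor
  · intro H
    by_contra hb
    have hdisj : Disjoint (h d : Set B) (Order.Ideal.principal b : Set B) := by
      rw [Set.disjoint_left]
      intro z hz hz'
      exact hb (Order.PFilter.mem_of_le (Order.Ideal.mem_principal.1 hz') hz)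
    obtain ⟨I, hI, hbI, hdI⟩ := DistribLattice.prime_ideal_of_disjoint_filter_ideal hdisj
    refine (evalHom_const (h := h) ⟨I, hI⟩ b).1 (H _ fun f => ?_)
      (hbI (Order.Ideal.mem_principal.2 le_rfl))
    obtain ⟨k, hk⟩ := (dvd_level_iff ⟨I, hI⟩ f.1 d).1 fun q =>
      Set.disjoint_left.1 hdI (f.2 d q)
    have hdn : d.1 * (n / d.1) = n := Nat.mul_div_cancel' d.2
    have hle := level_le ⟨I, hI⟩ f.1
    have hm : 0 < n / d.1 := Nat.pos_of_ne_zero fun e => by rw [e] at hdn; omega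
    refine ⟨k, ?_, ?_⟩
    · refine le_of_mul_le_mul_left (a := n / d.1) ?_ hm
      rw [← hk, mul_comm (n / d.1), hdn]
      exact hle
    · show (level ⟨I, hI⟩ f.1 : ℝ) / n = _
      have hm' : ((n / d.1 : ℕ) : ℝ) ≠ 0 := by exact_mod_cast hm.ne'
      have hdn' : (d.1 : ℝ) * ((n / d.1 : ℕ) : ℝ) = n := by exact_mod_cast hdn
      rw [hk, Nat.cast_mul, ← hdn', mul_comm (d.1 : ℝ), mul_div_mul_left _ _ hm']
  · intro hb g hg
    obtain ⟨I, hI, hgI⟩ := exists_prime_eq_seqVal g fun f => chain_mono hn0 d.2 (hg f)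
    rw [← hI]
    obtain ⟨r, hr⟩ := exists_least_divisor hself hgcd I
    obtain ⟨f, hf⟩ := exists_level_eq (h := h) I r fun d => (hr d).1
    refine (hr d).2 ?_ b hb
    -- the value `1/r` of `f` lies in `L_{d+1}`
    obtain ⟨k, -, hk⟩ := hg f
    rw [hgI] at hk
    have hk' : (level I f.1 : ℝ) / n = k / d.1 := hk
    have hd0 : (d.1 : ℝ) ≠ 0 := by
      exact_mod_cast (Nat.pos_of_dvd_of_pos d.2 hn0).ne'
    rw [hf, div_eq_div_iff hn hd0] at hk'
    have h1 : n / r.1 * d.1 = k * n := by exact_mod_cast hk'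
    have h2 : r.1 * (n / r.1) = n := Nat.mul_div_cancel' r.2
    refine ⟨k, ?_⟩
    have h3 : 0 < n / r.1 := Nat.pos_of_ne_zero fun e => by rw [e] at h2; omega
    refine Nat.eq_of_mul_eq_mul_left h3 ?_
    rw [h1]
    conv_lhs => rw [← h2]
    ring

end Counit

/-! ### The equivalence -/

section Equivalence

variable {n : ℕ}

/-- A bijective homomorphism is an isomorphism. -/
noncomputable def isoOfBijective {X Y : WAlg.{u} n} (f : X ⟶ Y)
    (hf : Function.Bijective (WHom.toFun f)) : X ≅ Y where
  hom := f
  inv :=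
    let e := Equiv.ofBijective _ hf
    { toFun := e.symm
      map_imp := fun x y => hf.1 (by
        have he : ∀ z, WHom.toFun f (e.symm z) = z := e.apply_symm_apply
        rw [WHom.map_imp, he, he, he])
      map_neg := fun x => hf.1 (by
        have he : ∀ z, WHom.toFun f (e.symm z) = z := e.apply_symm_apply
        rw [WHom.map_neg, he, he])
      map_one := hf.1 (by
        have he : ∀ z, WHom.toFun f (e.symm z) = z := e.apply_symm_apply
        rw [WHom.map_one, he]) }
  hom_inv_id := WHom.ext (funext (Equiv.ofBijective _ hf).symm_apply_apply)
  inv_hom_id := WHom.ext (funext (Equiv.ofBijective _ hf).apply_symm_apply)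

variable [NeZero n]

/-- The isomorphism `A ≅ M(B(A), h_A)`. -/
noncomputable def unitObjIso (A : WAlg.{u} n) : A ≅ (functorM n).obj ((functorB n).obj A) :=
  isoOfBijective (Y := (functorM n).obj ((functorB n).obj A)) (unitHom A.nvalued)
    ⟨unitHom_injective A.nvalued, unitHom_surjective A.nvalued⟩

/-- The isomorphism `B(M(B, h)) ≅ ⟨B, h⟩`. -/
def counitObjIso (X : BPair.{u} n) : (functorB n).obj ((functorM n).obj X) ≅ X where
  hom :=
    { hom := valueHom X.filt
      map_filt := fun d F hF => by
        refine (constHom_mem_boolFilter X.filt_self X.filt_gcd).1 ?_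
        have e : constHom X.filt (counitIso X.filt F) = F := (counitIso X.filt).symm_apply_apply F
        exact e.symm ▸ hF }
  inv :=
    { hom := constHom X.filt
      map_filt := fun d b hb => (constHom_mem_boolFilter X.filt_self X.filt_gcd).2 hb }
  hom_inv_id := BPair.Hom.ext (DFunLike.ext _ _ (counitIso X.filt).symm_apply_apply)
  inv_hom_id := BPair.Hom.ext (DFunLike.ext _ _ (counitIso X.filt).apply_symm_apply)

/-- The isomorphism `A ≅ M(B(A), h_A)` is natural, as the terms of the sequence of `x` are term
functions of `x`. -/
noncomputable def unitNatIso (n : ℕ) [NeZero n] : 𝟭 (WAlg.{u} n) ≅ functorB n ⋙ functorM n :=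
  NatIso.ofComponents unitObjIso fun g => WHom.ext (funext fun x =>
    Subtype.ext (OrderHom.ext _ _ (funext fun i => Subtype.ext
      (map_trunc g x n (n - i)).symm)))

/-- The isomorphism `B(M(B, h)) ≅ ⟨B, h⟩` is natural in `⟨B, h⟩`. -/
def counitNatIso (n : ℕ) [NeZero n] : functorM n ⋙ functorB n ≅ 𝟭 (BPair.{u} n) :=
  NatIso.ofComponents counitObjIso fun _ => rfl

end Equivalence

end Wajsberg

theorem mainTheorem2 (n : ℕ) [NeZero n] :
    ∃ e : Wajsberg.WAlg.{u} n ≌ Wajsberg.BPair.{u} n,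
      e.functor = Wajsberg.functorB.{u} n ∧ e.inverse = Wajsberg.functorM.{u} n :=
  ⟨CategoryTheory.Equivalence.mk _ _ (Wajsberg.unitNatIso n) (Wajsberg.counitNatIso n),
    rfl, rfl⟩
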